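/- Let $\Gamma$ be a countable discrete group and let $(X,T)$ be a $\Gamma$-dynamical system, i.e. $X$ is a compact metric space and $T:\Gamma\to\mathrm{Homeo}(X)$, $\gamma\mapsto T_\gamma$, is a homomorphism. Let $\mathrm{Prob}(X,T)$ be the set of $T$-invariant Borel probability measures on $X$ and $\mathrm{Cov}(X)$ the set of finite open covers of $X$. For covers write $\mathcal V\succeq\mathcal U$ if every $V\in\mathcal V$ is contained in some $U\in\mathcal U$, and put $\mathrm{ord}(\mathcal V,x)=-1+\sum_{V\in\mathcal V}\mathbf 1_V(x)$ and $\dim(\mathcal U)=\inf_{\mathcal V\in\mathrm{Cov}(X),\,\mathcal V\succeq\mathcal U}\ \sup_{x\in X}\mathrm{ord}(\mathcal V,x)$. Suprema and infima are taken in $[-\infty,+\infty]$. The dimension of $(X,T)$ is $$\dim(X,T)=\sup_{\mathcal U\in\mathrm{Cov}(X)}\ \inf_{\mathcal V\in\mathrm{Cov}(X),\,\mathcal V\succeq\mathcal U}\ \sup_{\mu\in\mathrm{Prob}(X,T)}\int_X\mathrm{ord}(\mathcal V,x)\,d\mu(x).$$ A Følner sequence is a sequence $(F_n)$ of nonempty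 finite subsets of $\Gamma$ with $|F_n\gamma\,\triangle\,F_n|/|F_n|\to0$ for every $\gamma\in\Gamma$; $\Gamma$ is amenable if one exists. For amenable $\Gamma$ the mean dimension is $$\mathrm{mdim}(X,T)=\sup_{\mathcal U\in\mathrm{Cov}(X)}\ \lim_{n\to\infty}\frac1{|F_n|}\dim\Big(\bigvee_{\gamma\in F_n}T_\gamma(\mathcal U)\Big),$$ where $\bigvee_{\gamma\in F}T_\gamma(\mathcal U)$ consists of the sets $\bigcap_{\gamma\in F}T_\gamma(U_\gamma)$ with all $U_\gamma\in\mathcal U$; it is part of the claims below that, for the systems considered, these limits exist and that the value is the same for every Følner sequence. The system $(X,T)$ has the uniform Rokhlin property if for every finite $K\subseteq\Gamma$ and every $\epsilon>0$ there are open sets $V_1,\dots,V_r\subseteq X$ and nonempty finite sets $S_1,\dots,S_r\subseteq\Gamma$ that are $(K,\epsilon)$-invariant (i.e. $|kS_i\,\triangle\,S_i|<\epsilon|S_i|$ for all $k\in K$) such that the sets $T_\gamma V_i$, indexed by the pairs $(i,\gamma)$ with $1\le i\le r$ and $\gamma\in S_i$, are pairwise disjoint and $\sup_{\mu\in\mathrm{Prob}(X,T)}\mu\big(X\setminus\bigcup_{i=1}^r\bigcup_{\gamma\in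 S_i}T_\gamma V_i\big)<\epsilon$. It has the marker property if for every finite $F\subseteq\Gamma$ there is an open $U\subseteq X$ with $U\cap T_\gamma U=\emptyset$ for all $\gamma\in F$ other than the identity and $\bigcup_{\gamma\in\Gamma}T_\gamma U=X$. **Theorem.** If $\Gamma$ is a countable amenable group and $(X,T)$ is a $\Gamma$-dynamical system with the uniform Rokhlin property, then $\mathrm{mdim}(X,T)=\dim(X,T)$. In particular, $\mathrm{mdim}(X,T)=\dim(X,T)$ holds for every $\mathbb Z^k$-dynamical system with the marker property, and for every $\mathbb Z^k$-dynamical system that is an extension of a free minimal $\mathbb Z^k$-dynamical system (i.e. that admits a continuous equivariant surjection onto it). -/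

import Mathlib

open scoped Pointwise symmDiff ENNReal Topology
open MeasureTheory Filter

namespace DynDim

noncomputable section

/-! ### Covers and their order -/

section Covers

variable {X : Type*}

/-- `ord(𝒱, x) = -1 + ∑_{V ∈ 𝒱} 1_V(x)` for a finite collection `𝒱` of subsets of `X`. -/
def ordAt (𝒱 : Finset (Set X)) (x : X) : ℝ :=
  -1 + ∑ V ∈ 𝒱, V.indicator (fun _ => (1 : ℝ)) x

/-- `ord(𝒱) = sup_{x ∈ X} ord(𝒱, x)`, which is `-∞` if `X` is empty. -/
def ord (𝒱 : Finset (Set X)) : EReal :=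
  ⨆ x : X, (ordAt 𝒱 x : EReal)

/-- `Refines 𝒱 𝒰`, i.e. `𝒱 ≽ 𝒰`: every element of `𝒱` is contained in some element of `𝒰`. -/
def Refines (𝒱 𝒰 : Set (Set X)) : Prop :=
  ∀ V ∈ 𝒱, ∃ U ∈ 𝒰, V ⊆ U

/-- A finite collection of subsets of `X` that is an open cover of `X`. -/
def IsOpenCover [TopologicalSpace X] (𝒰 : Finset (Set X)) : Prop :=
  (∀ U ∈ 𝒰, IsOpen U) ∧ ⋃ U ∈ 𝒰, U = Set.univ

/-- `dim(𝒰) = inf ord(𝒱)` over the finite open covers `𝒱` that refine `𝒰`. -/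
def coverDim [TopologicalSpace X] (𝒰 : Set (Set X)) : EReal :=
  ⨅ (𝒱 : Finset (Set X)) (_ : IsOpenCover 𝒱 ∧ Refines (𝒱 : Set (Set X)) 𝒰), ord 𝒱

/-- The joint refinement `⋁_{γ ∈ F} T_γ(𝒰)`: it consists of the sets `⋂_{γ ∈ F} T_γ(U_γ)` with
`U_γ ∈ 𝒰` for every `γ ∈ F`. -/
def iteratedJoin {Γ : Type*} [Group Γ] [MulAction Γ X] (F : Finset Γ) (𝒰 : Finset (Set X)) :
    Set (Set X) :=
  {A | ∃ u : Γ → Set X, (∀ γ ∈ F, u γ ∈ 𝒰) ∧ A = ⋂ γ ∈ F, γ • u γ}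

end Covers

/-! ### Amenability -/

section Groups

variable {Γ : Type*} [Group Γ]

open scoped Classical in
/-- `F` is a Følner sequence: a sequence of nonempty finite subsets of `Γ` such that
`|F_n γ ∆ F_n| / |F_n| → 0` for every `γ`. The translates are taken on the side that goes with the
joint refinements `⋁_{γ ∈ F_n} T_γ(𝒰)` of a left action. -/
def IsFolnerSeq (F : ℕ → Finset Γ) : Prop :=
  (∀ n, (F n).Nonempty) ∧
    ∀ γ : Γ, Tendsto
      (fun n => ((((F n).image (fun g => g * γ)) ∆ (F n)).card : ℝ) / ((F n).card : ℝ))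
      atTop (𝓝 0)

variable (Γ) in
/-- Amenability of a countable group, through the Følner criterion. -/
def IsAmenable : Prop :=
  ∃ F : ℕ → Finset Γ, IsFolnerSeq F

open scoped Classical in
/-- The finite set `S` is nonempty and `(K, ε)`-invariant: `|k S ∆ S| < ε |S|` for all `k ∈ K`. -/
def IsInvariantSet (K : Finset Γ) (ε : ℝ) (S : Finset Γ) : Prop :=
  S.Nonempty ∧
    ∀ k ∈ K, (((S.image (fun g => k * g)) ∆ S).card : ℝ) < ε * (S.card : ℝ)

end Groups

/-! ### Dynamical systems -/

section Systems

variable (Γ : Type*) [Group Γ] (X : Type*) [MulAction Γ X]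

/-- `Prob(X, T)`: the `T`-invariant Borel probability measures on `X`. -/
def invariantProb [MeasurableSpace X] : Set (Measure X) :=
  {μ | IsProbabilityMeasure μ ∧ SMulInvariantMeasure Γ X μ}

/-- `dim(X, T)`, the supremum over the finite open covers `𝒰` of `X` of the infimum over the finite
open covers `𝒱` refining `𝒰` of `sup_{μ ∈ Prob(X, T)} ∫ ord(𝒱, x) dμ(x)`. It is `-∞` if
`Prob(X, T)` is empty. -/
def dynDim [TopologicalSpace X] [MeasurableSpace X] : EReal :=
  ⨆ (𝒰 : Finset (Set X)) (_ : IsOpenCover 𝒰),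
    ⨅ (𝒱 : Finset (Set X)) (_ : IsOpenCover 𝒱 ∧ Refines (𝒱 : Set (Set X)) (𝒰 : Set (Set X))),
      ⨆ μ ∈ invariantProb Γ X, ((∫ x, ordAt 𝒱 x ∂μ : ℝ) : EReal)

/-- `mdim(X, T)` is defined and equal to `d`: the group is amenable, and for every Følner sequence
`(F_n)` and every finite open cover `𝒰` the limit
`L(𝒰) = lim_n dim(⋁_{γ ∈ F_n} T_γ(𝒰)) / |F_n|` exists, and `sup_𝒰 L(𝒰) = d`. -/
def HasMeanDim [TopologicalSpace X] (d : EReal) : Prop :=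
  IsAmenable Γ ∧
    ∀ F : ℕ → Finset Γ, IsFolnerSeq F →
      ∃ L : Finset (Set X) → EReal,
        (∀ 𝒰 : Finset (Set X), IsOpenCover 𝒰 →
          Tendsto (fun n => coverDim (iteratedJoin (F n) 𝒰) / ((F n).card : EReal))
            atTop (𝓝 (L 𝒰))) ∧
        ⨆ (𝒰 : Finset (Set X)) (_ : IsOpenCover 𝒰), L 𝒰 = d

/-- The capacity of `A`: the supremum of `μ(A)` over `μ ∈ Prob(X, T)`. -/
def capacity {X : Type*} [MulAction Γ X] [MeasurableSpace X] (A : Set X) : ℝ≥0∞ :=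
  ⨆ μ ∈ invariantProb Γ X, μ A

/-- The uniform Rokhlin property: for all finite `K ⊆ Γ` and `ε > 0` there are finitely many open
sets `V_i` and finite `(K, ε)`-invariant sets `S_i` such that the sets `T_γ V_i`, indexed by the
pairs `(i, γ)` with `γ ∈ S_i`, are pairwise disjoint and their union has a complement of capacity
less than `ε`. -/
def HasURP [TopologicalSpace X] [MeasurableSpace X] : Prop :=
  ∀ (K : Finset Γ) (ε : ℝ), 0 < ε →
    ∃ (r : ℕ) (V : Fin r → Set X) (S : Fin r → Finset Γ),
      (∀ i, IsOpen (V i)) ∧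
      (∀ i, IsInvariantSet K ε (S i)) ∧
      (∀ i, ∀ γ ∈ S i, ∀ j, ∀ δ ∈ S j, (i, γ) ≠ (j, δ) → Disjoint (γ • V i) (δ • V j)) ∧
      capacity Γ (⋃ i, ⋃ γ ∈ S i, γ • V i)ᶜ < ENNReal.ofReal ε

/-- The marker property: for every finite `F ⊆ Γ` there is an open set `U` whose translates cover
`X` and such that `U ∩ T_γ U = ∅` for every `γ ∈ F` other than the identity. -/
def HasMarkerProperty [TopologicalSpace X] : Prop :=
  ∀ F : Finset Γ, ∃ U : Set X, IsOpen U ∧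
    (∀ γ ∈ F, γ ≠ 1 → Disjoint U (γ • U)) ∧ ⋃ γ : Γ, γ • U = Set.univ

/-- The action is free: a point is fixed by no element other than the identity. -/
def IsFreeAction : Prop :=
  ∀ (γ : Γ) (x : X), γ • x = x → γ = 1

/-- `π : X → Y` makes `X` an extension of `Y`: it is continuous, equivariant and onto. -/
def IsFactorMap {X Y : Type*} [MulAction Γ X] [MulAction Γ Y] [TopologicalSpace X]
    [TopologicalSpace Y] (π : X → Y) : Prop :=
  Continuous π ∧ (∀ (γ : Γ) (x : X), π (γ • x) = γ • π x) ∧ Function.Surjective π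

end Systems

/-- The group `ℤᵏ`, written multiplicatively. -/
abbrev ZPow (k : ℕ) : Type := Multiplicative (Fin k → ℤ)

end

end DynDim

/-! The comparison is made one cover `𝒰` at a time: `HasURP.tendsto_coverDim` shows that the
normalized dimensions of its joins converge to the infimum, over refinements `𝒱` of `𝒰`, of the
largest integrated order. Taking suprema over `𝒰` then gives the equality and the independence of
the Følner sequence.

Upper bound. Suppose that `𝒱` has integrated order below `c` for all invariant measures. Limits of
empirical measures are invariant, so along a late Følner set every orbit has average order at most
`c`, once `𝒱` is shrunk to closed supports (`eventually_card_visits_le`). By `exists_joint_cover`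
the translates of `𝒱` have a common refinement whose order at a point is at most the sum of their
orders there. This half does not need Rokhlin towers.

Lower bound. If the normalized dimension is at most `a` along a subsequence, the Ornstein–Weiss
lemma gives nearly the same bound on all sufficiently invariant sets, in particular on the inverses
of the shapes `S` of Rokhlin towers. A refinement of the join over `S⁻¹` with order at most `a |S|`
lives on the base of a tower. Copying it to every level would cost a factor `|S|`; instead
`IsOpenCover.exists_split` distributes it into `|S|` covers whose orders add up to at most `a |S|`,
one for each level. Integration over the disjoint levels gives `a`, and an open neighbourhood of the
remainder has small capacity (`exists_isOpen_capacity_le`).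

Over `ℤᵏ`, a continuous marker function puts weights on the lattice points of each orbit, and the
resulting power diagram partitions space into large cells depending continuously on the point.
Aligning a grid of boxes with the site of each cell gives a single Rokhlin tower. That the boundary
is negligible follows by counting: contracting cells towards their sites moves a fine grid
injectively into the deep interiors. -/

namespace DynDim

/-! ### The Ornstein–Weiss lemma by quasi-tilings. -/

section OrnsteinWeiss

open scoped Classical

variable {Γ : Type*} [Group Γ]

/-- The number of elements of `D` that leave `D` under right multiplication by `g`. -/
noncomputable def escape (g : Γ) (D : Finset Γ) : ℕ := (D.filter (fun d => d * g ∉ D)).card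

/-- At most a proportion `δ` of the elements of `D` leaves `D` under right multiplication by an
element of `K`. -/
def RightInvariant (K : Finset Γ) (δ : ℝ) (D : Finset Γ) : Prop :=
  ∀ g ∈ K, (escape g D : ℝ) ≤ δ * D.card

theorem RightInvariant.mono {K K' : Finset Γ} {δ δ' : ℝ} {D : Finset Γ}
    (h : RightInvariant K δ D) (hK : K' ⊆ K) (hδ : δ ≤ δ') : RightInvariant K' δ' D :=
  fun g hg => (h g (hK hg)).trans (by gcongr)

theorem escape_smul (g c : Γ) (D : Finset Γ) : escape g (c • D) = escape g D := by
  unfold escape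
  have : ((c • D).filter fun d => d * g ∉ c • D) = c • (D.filter fun d => d * g ∉ D) := by
    ext x
    simp only [Finset.mem_filter, ← Finset.inv_smul_mem_iff, smul_eq_mul, mul_assoc]
  rw [this, Finset.card_smul_finset]

theorem escape_union_le (g : Γ) (A B : Finset Γ) :
    escape g (A ∪ B) ≤ escape g A + escape g B := by
  unfold escape
  refine (Finset.card_le_card ?_).trans (Finset.card_union_le _ _)
  intro x
  simp only [Finset.mem_filter, Finset.mem_union]
  tauto

theorem escape_biUnion_le (g : Γ) (C : Finset Γ) (t : Γ → Finset Γ) :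
    escape g (C.biUnion t) ≤ ∑ c ∈ C, escape g (t c) := by
  induction C using Finset.induction_on with
  | empty => simp [escape]
  | insert a s ha ih =>
    rw [Finset.biUnion_insert, Finset.sum_insert ha]
    exact (escape_union_le _ _ _).trans (by gcongr)

/-- An element leaves the difference by leaving `D` or by entering `A`; in the second case its image
leaves `A` under `g⁻¹`. -/
theorem escape_sdiff_le (g : Γ) (A D : Finset Γ) :
    escape g (D \ A) ≤ escape g D + escape g⁻¹ A := by
  unfold escape
  have : ((D \ A).filter fun d => d * g ∉ D \ A) ⊆
      (D.filter fun d => d * g ∉ D) ∪ (A.filter fun a => a * g⁻¹ ∉ A).image (· * g⁻¹) := by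
    intro x
    simp only [Finset.mem_filter, Finset.mem_union, Finset.mem_sdiff, Finset.mem_image, not_and,
      not_not]
    rintro ⟨⟨h1, h2⟩, h3⟩
    by_cases h4 : x * g ∈ D
    · exact Or.inr ⟨x * g, ⟨h3 h4, by simpa using h2⟩, by simp⟩
    · exact Or.inl ⟨h1, h4⟩
  refine (Finset.card_le_card this).trans ((Finset.card_union_le _ _).trans ?_)
  exact Nat.add_le_add_left Finset.card_image_le _

/-- The elements `c` for which the left translate `c F` lies in `D`. -/
noncomputable def innerTranslates (F D : Finset Γ) : Finset Γ :=
  (D * F⁻¹).filter fun c => c • F ⊆ D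

theorem mem_innerTranslates {F D : Finset Γ} (hF : F.Nonempty) {c : Γ} :
    c ∈ innerTranslates F D ↔ c • F ⊆ D := by
  simp only [innerTranslates, Finset.mem_filter, and_iff_right_iff_imp]
  intro h
  obtain ⟨f, hf⟩ := hF
  rw [Finset.mem_mul]
  exact ⟨c * f, h (Finset.smul_mem_smul_finset hf), f⁻¹, Finset.inv_mem_inv hf, by simp⟩

/-- Anchoring the translate of `F` so that `f₀` lands on `d`, it stays in `D` unless `d` escapes
under some `f₀⁻¹ f`. -/
theorem card_le_innerTranslates {F D : Finset Γ} {f₀ : Γ} (hf : f₀ ∈ F) :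
    D.card ≤ (innerTranslates F D).card + ∑ f ∈ F, escape (f₀⁻¹ * f) D := by
  have hsub : D ⊆ (innerTranslates F D).image (· * f₀) ∪
      F.biUnion fun f => D.filter fun d => d * (f₀⁻¹ * f) ∉ D := by
    intro d hd
    by_cases h : ∀ f ∈ F, d * (f₀⁻¹ * f) ∈ D
    · refine Finset.mem_union_left _ (Finset.mem_image.2 ⟨d * f₀⁻¹, ?_, by simp⟩)
      rw [mem_innerTranslates ⟨f₀, hf⟩]
      intro x hx
      obtain ⟨f, hf', rfl⟩ := Finset.mem_smul_finset.1 hx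
      simpa [mul_assoc] using h f hf'
    · push Not at h
      obtain ⟨f, hf', h⟩ := h
      exact Finset.mem_union_right _ (Finset.mem_biUnion.2 ⟨f, hf', by simp [hd, h]⟩)
  refine (Finset.card_le_card hsub).trans ((Finset.card_union_le _ _).trans ?_)
  exact Nat.add_le_add Finset.card_image_le Finset.card_biUnion_le

/-- A maximal family of almost disjoint translates of `F` inside `D`. -/
theorem exists_maximal_translates {F : Finset Γ} (hF : F.Nonempty) (D : Finset Γ) {ε : ℝ}
    (hε : ε < 1) :
    ∃ C : Finset Γ, C.biUnion (fun c => c • F) ⊆ D ∧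
      (1 - ε) * (C.card * F.card) ≤ ((C.biUnion fun c => c • F).card : ℝ) ∧
      ε * (innerTranslates F D).card ≤ ((C.biUnion fun c => c • F).card : ℝ) := by
  set P := innerTranslates F D
  have hFpos : (0 : ℝ) < F.card := by exact_mod_cast hF.card_pos
  obtain ⟨C, hC, hmax⟩ := Finset.exists_max_image
    (P.powerset.filter fun C => (1 - ε) * (C.card * F.card) ≤
      ((C.biUnion fun c => c • F).card : ℝ)) Finset.card ⟨∅, by simp⟩
  simp only [Finset.mem_filter, Finset.mem_powerset] at hC hmax
  obtain ⟨hCP, hCd⟩ := hC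
  set A := C.biUnion fun c => c • F with hA
  refine ⟨C, ?_, hCd, ?_⟩
  · intro x hx
    obtain ⟨c, hc, hx⟩ := Finset.mem_biUnion.1 hx
    exact (mem_innerTranslates hF).1 (hCP hc) hx
  -- A translate meeting `A` in less than `ε |F|` points could be added to `C`, against maximality;
  -- the members of `C` themselves lie in `A`, and `ε < 1`.
  have key : ∀ c ∈ P, ε * F.card ≤ ((c • F) ∩ A).card := by
    intro c hc
    by_contra hlt
    push Not at hlt
    have hcC : c ∉ C := by
      intro hcC
      have : c • F ∩ A = c • F := Finset.inter_eq_left.2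
        (Finset.subset_biUnion_of_mem (fun c => c • F) hcC)
      rw [this, Finset.card_smul_finset] at hlt
      nlinarith
    have h1 : ((c • F ∪ A).card : ℝ) + ((c • F) ∩ A).card = F.card + A.card := by
      have := Finset.card_union_add_card_inter (c • F) A
      rw [Finset.card_smul_finset] at this
      exact_mod_cast this
    have := hmax (insert c C) ⟨Finset.insert_subset hc hCP, by
      rw [Finset.biUnion_insert, Finset.card_insert_of_notMem hcC]
      push_cast
      linarith⟩
    rw [Finset.card_insert_of_notMem hcC] at this
    omega
  -- Double counting: a point lies in at most `|F|` translates of `F`.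
  have h2 : ∑ c ∈ P, ((c • F) ∩ A).card ≤ A.card * F.card := by
    have h3 : ∀ c, ((c • F) ∩ A).card = ∑ f ∈ F, if c * f ∈ A then 1 else 0 := by
      intro c
      rw [← Finset.card_filter]
      have : (c • F) ∩ A = c • (F.filter fun f => c * f ∈ A) := by
        ext x
        simp [← Finset.inv_smul_mem_iff]
      rw [this, Finset.card_smul_finset]
    simp only [h3]
    rw [Finset.sum_comm, mul_comm, ← smul_eq_mul]
    refine Finset.sum_le_card_nsmul _ _ _ fun f _ => ?_
    rw [← Finset.card_filter, ← Finset.card_image_of_injective _ (mul_left_injective f)]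
    refine Finset.card_le_card fun x hx => ?_
    obtain ⟨c, hc, rfl⟩ := Finset.mem_image.1 hx
    exact (Finset.mem_filter.1 hc).2
  have h4 : (P.card : ℝ) * (ε * F.card) ≤ A.card * F.card := by
    calc (P.card : ℝ) * (ε * F.card) = ∑ c ∈ P, ε * F.card := by simp
      _ ≤ ∑ c ∈ P, (((c • F) ∩ A).card : ℝ) := Finset.sum_le_sum key
      _ ≤ A.card * F.card := by exact_mod_cast h2
  nlinarith

theorem subadditive_biUnion_le {Γ : Type*} {h : Finset Γ → ℝ} (hempty : h ∅ ≤ 0) (hsub : ∀ A B, h (A ∪ B) ≤ h A + h B)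
    (s : Finset Γ) (t : Γ → Finset Γ) : h (s.biUnion t) ≤ ∑ c ∈ s, h (t c) := by
  induction s using Finset.induction_on with
  | empty => simpa using hempty
  | insert a s ha ih =>
    rw [Finset.biUnion_insert, Finset.sum_insert ha]
    exact (hsub _ _).trans (by gcongr)

variable {h : Finset Γ → ℝ} {C a : ℝ}

/-- Each round fills a proportion at least `ε / 2` of `D` with almost disjoint translates of a good
set `F`, at cost `a / (1 - ε)` per covered point. What is left is again invariant unless it is tiny,
so after `N` rounds the crude bound `C` applies only to a proportion `(1 - ε / 2) ^ N`, or to a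
remainder of proportion `ε`. -/
theorem ornstein_weiss_step (hC : 0 ≤ C) (ha : 0 ≤ a) (hbound : ∀ D, h D ≤ C * D.card)
    (hinv : ∀ (c : Γ) D, h (c • D) = h D) (hsub : ∀ A B, h (A ∪ B) ≤ h A + h B)
    (hfreq : ∀ (K : Finset Γ) (δ : ℝ), 0 < δ →
      ∃ F : Finset Γ, F.Nonempty ∧ RightInvariant K δ F ∧ h F ≤ a * F.card)
    {ε : ℝ} (hε0 : 0 < ε) (hε1 : ε < 1) (N : ℕ) :
    ∃ (K : Finset Γ) (δ : ℝ), 0 < δ ∧ ∀ D, RightInvariant K δ D →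
      h D ≤ (a / (1 - ε) + C * (1 - ε / 2) ^ N + C * ε) * D.card := by
  have hempty : h ∅ ≤ 0 := by simpa using hbound ∅
  have hb : 0 ≤ a / (1 - ε) := div_nonneg ha (by linarith)
  induction N with
  | zero =>
    refine ⟨∅, 1, one_pos, fun D _ => (hbound D).trans ?_⟩
    gcongr
    have := mul_nonneg hC hε0.le
    simp only [pow_zero, mul_one]
    linarith
  | succ N ih =>
    obtain ⟨K, δ, hδ, hK⟩ := ih
    -- `K⁻¹` serves the points that escape into the tiled part. The factor `1 - ε` pays for
    -- overlaps, since `|S| |F| ≤ |A| / (1 - ε)`, and `ε` for the remainder being smaller than `D`.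
    obtain ⟨F, hF, hFinv, hFa⟩ := hfreq (K ∪ K⁻¹) (δ * ε * (1 - ε) / 2)
      (by have : 0 < 1 - ε := by linarith
          positivity)
    obtain ⟨f₀, hf₀⟩ := id hF
    have hFpos : (0 : ℝ) < F.card := by exact_mod_cast hF.card_pos
    -- The second tolerance ensures that at least `|D| / 2` translates of `F` fit into `D`; the
    -- first keeps the remainder invariant.
    refine ⟨K ∪ F.image (fun f => f₀⁻¹ * f), min (δ * ε / 2) (1 / (2 * F.card)), by positivity,
      fun D hD => ?_⟩
    obtain ⟨S, hSD, hSd, hSP⟩ := exists_maximal_translates hF D hε1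
    set A := S.biUnion fun c => c • F with hA
    have hDc : (0 : ℝ) ≤ D.card := by positivity
    have hP : (D.card : ℝ) / 2 ≤ (innerTranslates F D).card := by
      have h1 : (D.card : ℝ) ≤ (innerTranslates F D).card + ∑ f ∈ F, (escape (f₀⁻¹ * f) D : ℝ) := by
        exact_mod_cast card_le_innerTranslates hf₀
      have h2 : ∑ f ∈ F, (escape (f₀⁻¹ * f) D : ℝ) ≤ F.card • (1 / (2 * F.card) * (D.card : ℝ)) := by
        refine Finset.sum_le_card_nsmul _ _ _ fun f hf => ?_
        refine (hD _ (Finset.mem_union_right _ (Finset.mem_image_of_mem _ hf))).trans ?_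
        gcongr
        exact min_le_right _ _
      have h3 : F.card • (1 / (2 * F.card) * (D.card : ℝ)) = D.card / 2 := by
        rw [nsmul_eq_mul]
        field_simp
      linarith
    have hAlow : ε / 2 * D.card ≤ (A.card : ℝ) := by nlinarith
    have hcard : ((D \ A).card : ℝ) + A.card = D.card := by
      exact_mod_cast Finset.card_sdiff_add_card_eq_card hSD
    have hSF : (S.card : ℝ) * F.card ≤ A.card / (1 - ε) := by
      rw [le_div_iff₀ (by linarith)]
      linarith
    have hAh : h A ≤ a / (1 - ε) * A.card := by
      calc h A ≤ ∑ c ∈ S, h (c • F) := subadditive_biUnion_le hempty hsub _ _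
        _ ≤ ∑ c ∈ S, a * F.card := Finset.sum_le_sum fun c _ => by rw [hinv]; exact hFa
        _ = a * (S.card * F.card) := by simp; ring
        _ ≤ a * (A.card / (1 - ε)) := by gcongr
        _ = _ := by ring
    have hsplit : h D ≤ h A + h (D \ A) := by
      have := hsub A (D \ A)
      rwa [Finset.union_sdiff_of_subset hSD] at this
    have hpow : 0 ≤ C * (1 - ε / 2) ^ N := mul_nonneg hC (pow_nonneg (by linarith) _)
    have hpow' : 0 ≤ C * (1 - ε / 2) ^ (N + 1) := mul_nonneg hC (pow_nonneg (by linarith) _)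
    have hCε : 0 ≤ C * ε := mul_nonneg hC hε0.le
    have hA0 : (0 : ℝ) ≤ A.card := by positivity
    have hDA0 : (0 : ℝ) ≤ (D \ A).card := by positivity
    by_cases hcase : ((D \ A).card : ℝ) ≤ ε * D.card
    · have h1 : h (D \ A) ≤ C * (ε * D.card) := (hbound _).trans (by gcongr)
      nlinarith [mul_nonneg hb hDA0, mul_nonneg hpow' hDc]
    · push Not at hcase
      have hinvD : RightInvariant K δ (D \ A) := by
        intro g hg
        have h1 : (escape g (D \ A) : ℝ) ≤ escape g D + escape g⁻¹ A := by
          exact_mod_cast escape_sdiff_le g A D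
        have h2 : (escape g D : ℝ) ≤ δ * ε / 2 * D.card :=
          (hD g (Finset.mem_union_left _ hg)).trans (by gcongr; exact min_le_left _ _)
        have h3 : (escape g⁻¹ A : ℝ) ≤ δ * ε / 2 * D.card := by
          calc (escape g⁻¹ A : ℝ) ≤ ∑ c ∈ S, (escape g⁻¹ (c • F) : ℝ) := by
                exact_mod_cast escape_biUnion_le g⁻¹ S _
            _ ≤ ∑ c ∈ S, δ * ε * (1 - ε) / 2 * F.card := Finset.sum_le_sum fun c _ => by
                rw [escape_smul]
                exact hFinv _ (Finset.mem_union_right _ (Finset.inv_mem_inv hg))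
            _ = δ * ε / 2 * ((1 - ε) * (S.card * F.card)) := by simp; ring
            _ ≤ δ * ε / 2 * A.card := by gcongr
            _ ≤ δ * ε / 2 * D.card := by gcongr
        calc (escape g (D \ A) : ℝ) ≤ δ * (ε * D.card) := by linarith
          _ ≤ δ * (D \ A).card := by gcongr
      have h1 := hK _ hinvD
      have h2 : (D \ A).card * (C * (1 - ε / 2) ^ N) ≤ C * (1 - ε / 2) ^ (N + 1) * D.card := by
        calc (D \ A).card * (C * (1 - ε / 2) ^ N)
            ≤ ((1 - ε / 2) * D.card) * (C * (1 - ε / 2) ^ N) := by gcongr; linarith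
          _ = _ := by ring
      nlinarith [mul_nonneg hCε hA0]

/-- The Ornstein–Weiss lemma: a left-invariant subadditive function of finite sets which on
arbitrarily invariant sets is at most `a` per element is so, up to an arbitrarily small error, on
all sufficiently invariant sets. -/
theorem ornstein_weiss (hC : 0 ≤ C) (ha : 0 ≤ a) (hbound : ∀ D, h D ≤ C * D.card)
    (hinv : ∀ (c : Γ) D, h (c • D) = h D) (hsub : ∀ A B, h (A ∪ B) ≤ h A + h B)
    (hfreq : ∀ (K : Finset Γ) (δ : ℝ), 0 < δ →
      ∃ F : Finset Γ, F.Nonempty ∧ RightInvariant K δ F ∧ h F ≤ a * F.card)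
    {η : ℝ} (hη : 0 < η) :
    ∃ (K : Finset Γ) (δ : ℝ), 0 < δ ∧ ∀ D, RightInvariant K δ D → h D ≤ (a + η) * D.card := by
  have hlim : Tendsto (fun ε : ℝ => a / (1 - ε) + C * ε) (𝓝[>] 0) (𝓝 (a / (1 - 0) + C * 0)) := by
    refine Tendsto.mono_left (ContinuousAt.tendsto ?_) nhdsWithin_le_nhds
    refine ContinuousAt.add (ContinuousAt.div ?_ ?_ (by norm_num)) ?_ <;> fun_prop
  have h1 : ∀ᶠ ε : ℝ in 𝓝[>] 0, a / (1 - ε) + C * ε < a + η / 2 :=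
    hlim.eventually_lt_const (by simp; linarith)
  have h2 : ∀ᶠ ε : ℝ in 𝓝[>] 0, ε < 1 := nhdsWithin_le_nhds (eventually_lt_nhds one_pos)
  obtain ⟨ε, ⟨h1, h2⟩, hε : 0 < ε⟩ := ((h1.and h2).and self_mem_nhdsWithin).exists
  have h3 : Tendsto (fun N : ℕ => C * (1 - ε / 2) ^ N) atTop (𝓝 (C * 0)) :=
    (tendsto_pow_atTop_nhds_zero_of_lt_one (by linarith) (by linarith)).const_mul C
  obtain ⟨N, hN⟩ := (h3.eventually_lt_const (show C * 0 < η / 2 by simp; linarith)).exists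
  obtain ⟨K, δ, hδ, hK⟩ := ornstein_weiss_step hC ha hbound hinv hsub hfreq hε h2 N
  exact ⟨K, δ, hδ, fun D hD => (hK D hD).trans
    (mul_le_mul_of_nonneg_right (by linarith) (by positivity))⟩

end OrnsteinWeiss

/-! ### Boxes as Følner sets of `ℤᵏ`. -/

section Boxes

open scoped Classical

/-- The box `[0, ℓ)ᵏ` in `ℤᵏ`. -/
noncomputable def intBox (k ℓ : ℕ) : Finset (Fin k → ℤ) := Fintype.piFinset fun _ => Finset.Ico 0 (ℓ : ℤ)

theorem mem_intBox {k ℓ : ℕ} {v : Fin k → ℤ} : v ∈ intBox k ℓ ↔ ∀ i, 0 ≤ v i ∧ v i < ℓ := by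
  simp [intBox]

theorem card_intBox (k ℓ : ℕ) : (intBox k ℓ).card = ℓ ^ k := by
  simp [intBox, Fintype.card_piFinset]

/-- The box `[0, ℓ)ᵏ` in the multiplicative group `ZPow k`. -/
noncomputable def box (k ℓ : ℕ) : Finset (ZPow k) := (intBox k ℓ).map Multiplicative.ofAdd.toEmbedding

theorem mem_box {k ℓ : ℕ} {g : ZPow k} : g ∈ box k ℓ ↔ g.toAdd ∈ intBox k ℓ := by
  simp [box]

theorem card_box (k ℓ : ℕ) : (box k ℓ).card = ℓ ^ k := by
  simp [box, card_intBox]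

theorem box_nonempty (k : ℕ) {ℓ : ℕ} (hℓ : 0 < ℓ) : (box k ℓ).Nonempty := by
  rw [← Finset.card_pos, card_box]
  positivity

/-- The inner box `[A, ℓ - A)ᵏ` stays inside the box after the translation. -/
theorem card_box_translate_sdiff_le {k ℓ A : ℕ} (hA : 2 * A ≤ ℓ) (a : ZPow k)
    (ha : ∀ i, |a.toAdd i| ≤ A) :
    (((box k ℓ).filter fun g => g * a ∉ box k ℓ).card : ℝ) ≤
      (ℓ : ℝ) ^ k - ((ℓ : ℝ) - 2 * A) ^ k := by
  have h1 : (ℓ - 2 * A) ^ k ≤ ((box k ℓ).filter fun g => g * a ∈ box k ℓ).card := by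
    have : ((Fintype.piFinset fun _ : Fin k => Finset.Ico (A : ℤ) ((ℓ : ℤ) - A)).map
        Multiplicative.ofAdd.toEmbedding).card = (ℓ - 2 * A) ^ k := by
      rw [Finset.card_map, Fintype.card_piFinset]
      simp only [Int.card_Ico, Finset.prod_const, Finset.card_univ, Fintype.card_fin]
      congr 1
      omega
    rw [← this]
    refine Finset.card_le_card fun g hg => ?_
    simp only [Finset.mem_map_equiv, Fintype.mem_piFinset, Finset.mem_Ico] at hg
    simp only [Finset.mem_filter, mem_box, mem_intBox, toAdd_mul, Pi.add_apply]
    refine ⟨fun i => ?_, fun i => ?_⟩ <;>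
    · have h1 := hg i
      have h2 := abs_le.1 (ha i)
      change (A : ℤ) ≤ Multiplicative.toAdd g i ∧ Multiplicative.toAdd g i < _ at h1
      constructor <;> omega
  have h2 := Finset.card_filter_add_card_filter_not (s := box k ℓ) (fun g => g * a ∈ box k ℓ)
  rw [card_box] at h2
  have h3 : ((ℓ - 2 * A : ℕ) : ℝ) = (ℓ : ℝ) - 2 * A := by
    rw [Nat.cast_sub hA]
    simp
  have h4 : ((ℓ : ℝ) - 2 * A) ^ k ≤ (((box k ℓ).filter fun g => g * a ∈ box k ℓ).card : ℝ) := by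
    rw [← h3]
    exact_mod_cast h1
  have h5 : ((((box k ℓ).filter fun g => g * a ∈ box k ℓ).card : ℝ)) +
      ((box k ℓ).filter fun g => g * a ∉ box k ℓ).card = (ℓ : ℝ) ^ k := by exact_mod_cast h2
  linarith

theorem tendsto_card_box_symmDiff (k : ℕ) (a : ZPow k) :
    Tendsto (fun ℓ : ℕ => ((((box k ℓ).image fun g => g * a) ∆ box k ℓ).card : ℝ) /
      ((box k ℓ).card : ℝ)) atTop (𝓝 0) := by
  obtain ⟨A, hA⟩ : ∃ A : ℕ, ∀ i, |a.toAdd i| ≤ A := by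
    refine ⟨∑ i, (a.toAdd i).natAbs, fun i => ?_⟩
    rw [Int.abs_eq_natAbs]
    exact_mod_cast Finset.single_le_sum (f := fun i => (a.toAdd i).natAbs)
      (fun _ _ => Nat.zero_le _) (Finset.mem_univ i)
  have hlim : Tendsto (fun ℓ : ℕ => 2 * (1 - (1 - 2 * (A : ℝ) / ℓ) ^ k)) atTop
      (𝓝 (2 * (1 - (1 - 0) ^ k))) := by
    have : Tendsto (fun ℓ : ℕ => 2 * (A : ℝ) / ℓ) atTop (𝓝 0) :=
      tendsto_const_nhds.div_atTop tendsto_natCast_atTop_atTop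
    exact ((this.const_sub 1).pow k |>.const_sub 1).const_mul 2
  simp only [sub_zero, one_pow, sub_self, mul_zero] at hlim
  refine tendsto_of_tendsto_of_tendsto_of_le_of_le' tendsto_const_nhds hlim
    (Eventually.of_forall fun ℓ => by positivity) ?_
  filter_upwards [eventually_ge_atTop (2 * A + 1)] with ℓ hℓ
  have hℓ0 : (0 : ℝ) < ℓ := by
    have : 0 < ℓ := by omega
    exact_mod_cast this
  have h1 := card_box_translate_sdiff_le (ℓ := ℓ) (by omega) a hA
  have h2 := card_box_translate_sdiff_le (ℓ := ℓ) (A := A) (by omega) a⁻¹ (by simpa using hA)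
  have h3 : (((box k ℓ).image fun g => g * a) ∆ box k ℓ).card ≤
      ((box k ℓ).filter fun g => g * a ∉ box k ℓ).card +
      ((box k ℓ).filter fun g => g * a⁻¹ ∉ box k ℓ).card := by
    rw [symmDiff_def]
    refine (Finset.card_union_le _ _).trans (Nat.add_le_add ?_ ?_)
    · refine le_trans (Finset.card_le_card fun x hx => ?_)
        (Finset.card_image_le (f := fun g => g * a))
      obtain ⟨hx1, hx⟩ := Finset.mem_sdiff.1 hx
      obtain ⟨g, hg, rfl⟩ := Finset.mem_image.1 hx1
      exact Finset.mem_image_of_mem _ (Finset.mem_filter.2 ⟨hg, hx⟩)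
    · refine Finset.card_le_card fun x hx => ?_
      obtain ⟨hx1, hx⟩ := Finset.mem_sdiff.1 hx
      exact Finset.mem_filter.2 ⟨hx1, fun h => hx (Finset.mem_image.2 ⟨_, h, by simp⟩)⟩
  have h4 : ((((box k ℓ).image fun g => g * a) ∆ box k ℓ).card : ℝ) ≤
      2 * ((ℓ : ℝ) ^ k - ((ℓ : ℝ) - 2 * A) ^ k) := by
    have : ((((box k ℓ).image fun g => g * a) ∆ box k ℓ).card : ℝ) ≤ _ := Nat.cast_le.2 h3
    push_cast at this
    linarith
  rw [card_box]
  push_cast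
  rw [div_le_iff₀ (by positivity)]
  refine h4.trans (le_of_eq ?_)
  have : (ℓ : ℝ) - 2 * A = (1 - 2 * A / ℓ) * ℓ := by field_simp
  rw [this, mul_pow]
  ring

theorem isAmenable_zPow (k : ℕ) : IsAmenable (ZPow k) :=
  ⟨fun n => box k (n + 1), fun n => box_nonempty k n.succ_pos,
    fun γ => by
      have := (tendsto_card_box_symmDiff k γ).comp (tendsto_add_atTop_nat 1)
      refine this.congr fun n => ?_
      simp only [Function.comp_apply]
      congr!⟩

theorem exists_isInvariantSet_box (k : ℕ) (K : Finset (ZPow k)) {ε : ℝ} (hε : 0 < ε) :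
    ∃ ℓ : ℕ, 0 < ℓ ∧ IsInvariantSet K ε (box k ℓ) := by
  have h1 : ∀ a ∈ K, ∀ᶠ ℓ : ℕ in atTop, ((((box k ℓ).image fun g => g * a) ∆ box k ℓ).card : ℝ) /
      ((box k ℓ).card : ℝ) < ε := fun a _ =>
    (tendsto_card_box_symmDiff k a).eventually_lt_const hε
  have h2 := (Finset.eventually_all K).2 h1
  obtain ⟨ℓ, hℓ, hpos⟩ := (h2.and (eventually_gt_atTop 0)).exists
  refine ⟨ℓ, hpos, box_nonempty k hpos, fun a ha => ?_⟩
  have h3 := hℓ a ha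
  have h4 : (0 : ℝ) < (box k ℓ).card := by exact_mod_cast (box_nonempty k hpos).card_pos
  rw [div_lt_iff₀ h4] at h3
  have h5 : (fun g => a * g) = fun g => g * a := funext fun g => mul_comm a g
  rw [h5]
  convert! h3

end Boxes

/-! ### Power diagrams on the lattice and the depth of their cells. -/

section PowerDiagram

open scoped Classical

variable {k : ℕ}

/-- The squared Euclidean distance between a point of `ℝᵏ` and a point of `ℤᵏ`. -/
def sqDist (v : Fin k → ℝ) (n : Fin k → ℤ) : ℝ := ∑ i, (v i - n i) ^ 2

theorem sqDist_nonneg (v : Fin k → ℝ) (n : Fin k → ℤ) : 0 ≤ sqDist v n :=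
  Finset.sum_nonneg fun _ _ => sq_nonneg _

theorem abs_sub_le_of_sqDist_le {v : Fin k → ℝ} {n : Fin k → ℤ} {R : ℝ} (hR : 1 ≤ R)
    (h : sqDist v n ≤ R) (i : Fin k) : |v i - n i| ≤ R := by
  have h1 : (v i - n i) ^ 2 ≤ R :=
    (Finset.single_le_sum (f := fun i => (v i - n i) ^ 2) (fun _ _ => sq_nonneg _)
      (Finset.mem_univ i)).trans h
  rw [← sq_abs] at h1
  by_contra hlt
  push Not at hlt
  nlinarith

theorem finite_sqDist_le (v : Fin k → ℝ) (R : ℝ) : {n : Fin k → ℤ | sqDist v n ≤ R}.Finite := by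
  refine (Set.finite_Icc (fun i => ⌊v i - max R 1⌋) (fun i => ⌈v i + max R 1⌉)).subset ?_
  intro n hn
  have h : ∀ i, |v i - n i| ≤ max R 1 :=
    abs_sub_le_of_sqDist_le (le_max_right _ _) (hn.trans (le_max_left _ _))
  refine ⟨fun i => ?_, fun i => ?_⟩
  · have := (abs_le.1 (h i)).2
    have h2 := Int.floor_le (v i - max R 1)
    have h3 : (⌊v i - max R 1⌋ : ℝ) ≤ n i := by linarith
    exact_mod_cast h3
  · have := (abs_le.1 (h i)).1
    have h2 := Int.le_ceil (v i + max R 1)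
    have h3 : (n i : ℝ) ≤ ⌈v i + max R 1⌉ := by linarith
    exact_mod_cast h3

/-- Nonnegative weights leave only finitely many sites at least as good as the site `0`. -/
theorem exists_min_cost (h : (Fin k → ℤ) → ℝ) (hh : ∀ n, 0 ≤ h n) (u : Fin k → ℝ) :
    ∃ n, ∀ m, sqDist u n + h n ≤ sqDist u m + h m := by
  have hfin : {n : Fin k → ℤ | sqDist u n + h n ≤ sqDist u 0 + h 0}.Finite :=
    (finite_sqDist_le u (sqDist u 0 + h 0)).subset fun n hn => by
      have := hh n
      have hn' : sqDist u n + h n ≤ sqDist u 0 + h 0 := hn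
      change sqDist u n ≤ _
      linarith
  obtain ⟨n, hn, hmin⟩ := Set.exists_min_image _ (fun n => sqDist u n + h n) hfin
    ⟨0, by simp⟩
  refine ⟨n, fun m => ?_⟩
  by_cases hm : sqDist u m + h m ≤ sqDist u 0 + h 0
  · exact hmin m hm
  · exact le_trans hn (le_of_not_ge hm)

/-- The site `n` strictly owns the point `v` in the power diagram with weights `h`. -/
def StrictlyOwns (h : (Fin k → ℤ) → ℝ) (n : Fin k → ℤ) (v : Fin k → ℝ) : Prop :=
  ∀ m, m ≠ n → sqDist v n + h n < sqDist v m + h m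

theorem StrictlyOwns.eq {h : (Fin k → ℤ) → ℝ} {n m : Fin k → ℤ} {v : Fin k → ℝ}
    (hn : StrictlyOwns h n v) (hm : StrictlyOwns h m v) : n = m := by
  by_contra hne
  exact lt_asymm (hn m (Ne.symm hne)) (hm n hne)

/-- Weights on `ℤᵏ` with values in `[0, M]`, for which distinct sites of weight less than `M` are
at distance more than `r` and the sites of weight zero are relatively dense. -/
structure GoodWeights (h : (Fin k → ℤ) → ℝ) (M Λ : ℝ) (r : ℕ) : Prop where
  nonneg : ∀ n, 0 ≤ h n
  le : ∀ n, h n ≤ M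
  separated : ∀ n m, h n < M → h m < M → n ≠ m → ∃ i, (r : ℤ) < |n i - m i|
  dense : ∀ u : Fin k → ℝ, ∃ n, h n = 0 ∧ sqDist u n ≤ Λ

/-- Contracting a point towards its owner while scaling the weights makes the ownership strict on a
neighbourhood of the point. -/
theorem strictlyOwns_of_contraction {h : (Fin k → ℤ) → ℝ} {M Λ s ρ : ℝ} {r : ℕ}
    (hg : GoodWeights h M Λ r) (hs0 : 0 < s) (hs1 : s < 1)
    (hr : k * (ρ ^ 2 / (1 - s)) < (1 - s) * r ^ 2 - 2 * ρ * r) (hr' : ρ < (1 - s) * r)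
    (hM : k * (ρ ^ 2 / (1 - s)) < s * (M - Λ)) {u : Fin k → ℝ} {n : Fin k → ℤ}
    (hn : ∀ m, sqDist u n + h n ≤ sqDist u m + h m) {v : Fin k → ℝ}
    (hv : ∀ i, |v i - (n i + s * (u i - n i))| ≤ ρ) :
    StrictlyOwns (fun m => s * h m) n v := by
  intro m hm
  have hs : 0 < 1 - s := by linarith
  -- The margin gained in one coordinate where the two sites differ by `t`: contraction gains `(1 -
  -- s) t²`, and a displacement of at most `ρ` loses at most `2 ρ t`.
  set q : ℝ → ℝ := fun t => (1 - s) * t ^ 2 - 2 * ρ * t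
  have hq : ∀ t, -(ρ ^ 2 / (1 - s)) ≤ q t := by
    intro t
    have : 0 ≤ (1 - s) * (t - ρ / (1 - s)) ^ 2 := by positivity
    have h2 : (1 - s) * (t - ρ / (1 - s)) ^ 2 = q t + ρ ^ 2 / (1 - s) := by
      simp only [q]
      field_simp
      ring
    linarith
  obtain ⟨g, hg0, hgΛ⟩ := hg.dense u
  have hnΛ : sqDist u n + h n ≤ Λ := by
    have := hn g
    rw [hg0] at this
    linarith
  have hkρ : 0 ≤ k * (ρ ^ 2 / (1 - s)) := by positivity
  have hnM : h n < M := by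
    have h1 := sqDist_nonneg u n
    have : 0 < M - Λ := by
      by_contra hneg
      push Not at hneg
      nlinarith
    linarith
  have hkey : s * (sqDist u m - sqDist u n) + ∑ i, q |(n i : ℝ) - m i| ≤
      sqDist v m - sqDist v n := by
    simp only [sqDist, ← Finset.sum_sub_distrib, Finset.mul_sum, ← Finset.sum_add_distrib]
    refine Finset.sum_le_sum fun i _ => ?_
    have h1 : -(ρ * |(n i : ℝ) - m i|) ≤
        (v i - (n i + s * (u i - n i))) * ((n i : ℝ) - m i) := by
      have := abs_mul (v i - (n i + s * (u i - n i))) ((n i : ℝ) - m i)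
      have h3 := neg_abs_le ((v i - (n i + s * (u i - n i))) * ((n i : ℝ) - m i))
      have h4 := mul_le_mul_of_nonneg_right (hv i) (abs_nonneg ((n i : ℝ) - m i))
      linarith
    simp only [q, sq_abs]
    nlinarith
  -- A site of weight below `M` is far from `n` in some coordinate, and there `q` outweighs its
  -- possible negative values elsewhere. A site of weight `M` may be close, but loses by `M - Λ`
  -- already at `u`.
  by_cases hmM : h m < M
  · obtain ⟨i, hi⟩ := hg.separated n m hnM hmM (Ne.symm hm)
    have hi' : (r : ℝ) ≤ |(n i : ℝ) - m i| := by exact_mod_cast hi.le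
    have hqi : k * (ρ ^ 2 / (1 - s)) < q |(n i : ℝ) - m i| := by
      have hr0 : (0 : ℝ) ≤ r := by positivity
      have : (1 - s) * r ^ 2 - 2 * ρ * r ≤ q |(n i : ℝ) - m i| := by
        simp only [q]
        nlinarith [mul_nonneg (sub_nonneg.2 hi') hs.le]
      linarith
    have hsum : 0 < ∑ i, q |(n i : ℝ) - m i| := by
      rw [← Finset.add_sum_erase _ _ (Finset.mem_univ i)]
      have h2 : ∑ j ∈ Finset.univ.erase i, -(ρ ^ 2 / (1 - s)) ≤
          ∑ j ∈ Finset.univ.erase i, q |(n j : ℝ) - m j| := Finset.sum_le_sum fun j _ => hq _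
      have h3 : -(k * (ρ ^ 2 / (1 - s))) ≤ ∑ j ∈ Finset.univ.erase i, -(ρ ^ 2 / (1 - s)) := by
        rw [Finset.sum_const, Finset.card_erase_of_mem (Finset.mem_univ i), Finset.card_univ,
          Fintype.card_fin, nsmul_eq_mul, mul_neg, neg_le_neg_iff]
        gcongr
        exact_mod_cast Nat.sub_le k 1
      linarith
    have := hn m
    nlinarith
  · have hmM' : h m = M := le_antisymm (hg.le m) (not_lt.1 hmM)
    have hsum : -(k * (ρ ^ 2 / (1 - s))) ≤ ∑ i, q |(n i : ℝ) - m i| := by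
      have : ∑ i : Fin k, -(ρ ^ 2 / (1 - s)) ≤ ∑ i, q |(n i : ℝ) - m i| :=
        Finset.sum_le_sum fun j _ => hq _
      simpa using this
    have h1 := sqDist_nonneg u m
    simp only [hmM']
    nlinarith

/-- In a large box, most lattice points `z` have the property that a single site strictly owns all
the lattice points near `z`. -/
theorem card_deep_ge {h : (Fin k → ℤ) → ℝ} {M : ℝ} {Λ r p ℓ : ℕ} (hp : 0 < p) (hΛ : 0 < Λ)
    (hg : GoodWeights h M Λ r)
    (hr : k * (((ℓ : ℝ) + 1) ^ 2 / (1 - (p : ℝ) / (p + 1))) <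
      (1 - (p : ℝ) / (p + 1)) * r ^ 2 - 2 * (ℓ + 1) * r)
    (hr' : (ℓ : ℝ) + 1 < (1 - (p : ℝ) / (p + 1)) * r)
    (hM : k * (((ℓ : ℝ) + 1) ^ 2 / (1 - (p : ℝ) / (p + 1))) < (p : ℝ) / (p + 1) * (M - Λ))
    (T : ℕ) :
    (p * T) ^ k ≤ (p + 1) ^ k *
      ((Fintype.piFinset fun _ : Fin k => Finset.Icc (-(Λ : ℤ)) (T + Λ)).filter fun z =>
        ∃ n, ∀ v : Fin k → ℤ, (∀ i, |v i - z i| ≤ ℓ) →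
          StrictlyOwns (fun m => (p : ℝ) / (p + 1) * h m) n (fun i => (v i : ℝ))).card := by
  set s : ℝ := (p : ℝ) / (p + 1) with hs
  have hp' : (0 : ℝ) < p := by exact_mod_cast hp
  have hs0 : 0 < s := by positivity
  have hs1 : s < 1 := by
    rw [hs, div_lt_one (by positivity)]
    linarith
  have hΛ1 : (1 : ℝ) ≤ Λ := by exact_mod_cast hΛ
  choose N hN using fun w : Fin k → ℤ => exists_min_cost h hg.nonneg fun i => (w i : ℝ) / p
  have hclose : ∀ w i, |(w i : ℝ) / p - N w i| ≤ Λ := by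
    intro w
    refine abs_sub_le_of_sqDist_le hΛ1 ?_
    obtain ⟨g, hg0, hgΛ⟩ := hg.dense fun i => (w i : ℝ) / p
    have h1 := hN w g
    have h2 := hg.nonneg (N w)
    linarith
  -- The ratio `p / (p + 1)` makes the contraction send the grid of mesh `1 / p` into the grid of
  -- mesh `1 / (p + 1)`.
  have hcontr : ∀ (w : Fin k → ℤ) i,
      (N w i + s * ((w i : ℝ) / p - N w i)) = ((w i + N w i : ℤ) : ℝ) / (p + 1) := by
    intro w i
    rw [hs]
    push_cast
    field_simp
    ring
  have hown : ∀ (w : Fin k → ℤ) (v : Fin k → ℝ),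
      (∀ i, |v i - ((w i + N w i : ℤ) : ℝ) / (p + 1)| ≤ (ℓ : ℝ) + 1) →
      StrictlyOwns (fun m => s * h m) (N w) v := by
    intro w v hv
    refine strictlyOwns_of_contraction hg hs0 hs1 hr hr' hM (hN w) fun i => ?_
    rw [hcontr]
    exact hv i
  set f : (Fin k → ℤ) → (Fin k → ℤ) := fun w => w + N w with hf
  -- The contracted point is strictly owned by `N w`, so it determines `N w`, and then `w`. This
  -- replaces any estimate of the volume of cell boundaries.
  have hinj : Function.Injective f := by
    intro w w' hww
    have hww' : ∀ i, w i + N w i = w' i + N w' i := fun i => congrFun hww i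
    have h1 := hown w (fun i => ((w i + N w i : ℤ) : ℝ) / (p + 1))
      (fun i => by rw [sub_self, abs_zero]; positivity)
    have h2 := hown w' (fun i => ((w i + N w i : ℤ) : ℝ) / (p + 1))
      (fun i => by rw [hww', sub_self, abs_zero]; positivity)
    have h3 := h1.eq h2
    funext i
    have := hww' i
    rw [h3] at this
    linarith
  set fl : (Fin k → ℤ) → (Fin k → ℤ) := fun y i => y i / ((p : ℤ) + 1) with hfl
  -- Rounding the mesh `1 / (p + 1)` grid down to `ℤᵏ` is at most `(p + 1) ^ k` to one.
  have hfibre := Finset.card_le_mul_card_image (f := fl) ((intBox k (p * T)).image f)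
    ((p + 1) ^ k) (by
      intro z _
      have : (Fintype.piFinset fun i => Finset.Ico (((p : ℤ) + 1) * z i)
          (((p : ℤ) + 1) * z i + ((p : ℤ) + 1))).card = (p + 1) ^ k := by
        rw [Fintype.card_piFinset]
        simp only [Int.card_Ico, add_sub_cancel_left, Finset.prod_const, Finset.card_univ,
          Fintype.card_fin]
        congr 1
      rw [← this]
      refine Finset.card_le_card fun y hy => ?_
      rw [Finset.mem_filter] at hy
      rw [Fintype.mem_piFinset]
      intro i
      have hzi : z i = y i / ((p : ℤ) + 1) := by rw [← hy.2]
      have hpos : (0 : ℤ) < (p : ℤ) + 1 := by positivity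
      have h1 := Int.mul_ediv_add_emod (y i) ((p : ℤ) + 1)
      have h2 := Int.emod_nonneg (y i) hpos.ne'
      have h3 := Int.emod_lt_of_pos (y i) hpos
      rw [Finset.mem_Ico, hzi]
      constructor <;> linarith)
  rw [Finset.card_image_of_injective _ hinj, card_intBox] at hfibre
  refine hfibre.trans (Nat.mul_le_mul_left _ (Finset.card_le_card ?_))
  rw [Finset.image_image]
  intro z hz
  obtain ⟨w, hw, rfl⟩ := Finset.mem_image.1 hz
  rw [mem_intBox] at hw
  have hpos : (0 : ℤ) < (p : ℤ) + 1 := by positivity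
  have hposR : (0 : ℝ) < (p : ℝ) + 1 := by positivity
  -- Rounding moves each coordinate by less than `1`, which is why the ownership radius is `ℓ + 1`
  -- and not `ℓ`.
  have hz1 : ∀ i, ((w i + N w i : ℤ) : ℝ) / (p + 1) - 1 < (fl (f w) i : ℤ) := by
    intro i
    have h3 := Int.lt_ediv_add_one_mul_self (w i + N w i) hpos
    have h4 : ((w i + N w i : ℤ) : ℝ) < (((w i + N w i) / ((p : ℤ) + 1) : ℤ) + 1) * ((p : ℝ) + 1) := by
      exact_mod_cast h3
    rw [← div_lt_iff₀ hposR] at h4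
    change _ < (((w i + N w i) / ((p : ℤ) + 1) : ℤ) : ℝ)
    linarith
  have hz2 : ∀ i, (fl (f w) i : ℤ) ≤ ((w i + N w i : ℤ) : ℝ) / (p + 1) := by
    intro i
    have h3 := Int.ediv_mul_le (w i + N w i) hpos.ne'
    rw [le_div_iff₀ hposR]
    exact_mod_cast h3
  rw [Finset.mem_filter, Fintype.mem_piFinset]
  refine ⟨fun i => ?_, N w, fun v hv => hown w _ fun i => ?_⟩
  · have h1 := abs_le.1 (hclose w i)
    have hw1 : (0 : ℝ) ≤ w i := by exact_mod_cast (hw i).1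
    have hw2 : (w i : ℝ) ≤ p * T := by exact_mod_cast (hw i).2.le
    have h0 : (0 : ℝ) ≤ (w i : ℝ) / p := by positivity
    have h2 : (w i : ℝ) / p ≤ T := by
      rw [div_le_iff₀ hp']
      linarith
    have h3 : ((w i + N w i : ℤ) : ℝ) / (p + 1) =
        (w i : ℝ) / p + (N w i - (w i : ℝ) / p) / (p + 1) := by
      push_cast
      field_simp
      ring
    have h4 : |(N w i - (w i : ℝ) / p) / (p + 1)| ≤ Λ := by
      rw [abs_div, abs_of_pos hposR, abs_sub_comm]
      exact (div_le_self (abs_nonneg _) (by linarith)).trans (hclose w i)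
    have h5 := abs_le.1 h4
    rw [Finset.mem_Icc]
    constructor
    · have := hz1 i
      rw [h3] at this
      have h6 : (-(Λ : ℤ) - 1 : ℝ) < (fl (f w) i : ℤ) := by push_cast; linarith
      have : -(Λ : ℤ) - 1 < fl (f w) i := by exact_mod_cast h6
      change _ ≤ fl (f w) i
      linarith
    · have := hz2 i
      rw [h3] at this
      have h6 : ((fl (f w) i : ℤ) : ℝ) ≤ T + Λ := by linarith
      exact_mod_cast h6
  · have h1 : |(v i : ℝ) - fl (f w) i| ≤ ℓ := by exact_mod_cast hv i
    have h2 := hz1 i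
    have h3 := hz2 i
    rw [abs_le] at h1 ⊢
    constructor <;> linarith [h1.1, h1.2]

end PowerDiagram

/-! ### From the marker property of `ℤᵏ`-systems to Rokhlin towers. -/

section Marker

open scoped Classical

/-- A marker set may be replaced by a continuous function supported in it. -/
theorem HasMarkerProperty.exists_function {Γ X : Type*} [Group Γ] [TopologicalSpace X]
    [CompactSpace X] [NormalSpace X] [MulAction Γ X] [ContinuousConstSMul Γ X]
    (h : HasMarkerProperty Γ X) (F : Finset Γ) :
    ∃ (φ : C(X, ℝ)) (A : Finset Γ), (∀ x, φ x ∈ Set.Icc (0 : ℝ) 1) ∧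
      (∀ γ ∈ F, ∀ x, 0 < φ x → 0 < φ (γ • x) → γ = 1) ∧ ∀ x, ∃ a ∈ A, φ (a • x) = 1 := by
  obtain ⟨U, hU, hdisj, hcov⟩ := h F
  obtain ⟨t, ht⟩ := isCompact_univ.elim_finite_subcover (fun γ : Γ => γ • U)
    (fun γ => hU.smul γ) hcov.ge
  -- Shrinking the finite subcover to closed sets and moving these back into `U` gives a closed
  -- subset of `U` whose translates still cover; `φ` is an Urysohn function for it.
  obtain ⟨v, hv, hvc, hvU⟩ := exists_iUnion_eq_closed_subset (u := fun γ : t => (γ : Γ) • U)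
    (fun γ => hU.smul _) (fun x => Set.toFinite _) (by
      rw [Set.eq_univ_iff_forall]
      intro x
      have := ht (Set.mem_univ x)
      simp only [Set.mem_iUnion] at this ⊢
      obtain ⟨γ, hγ, hx⟩ := this
      exact ⟨⟨γ, hγ⟩, hx⟩)
  have hC : IsClosed (⋃ γ : t, (γ : Γ)⁻¹ • v γ) :=
    isClosed_iUnion_of_finite fun γ => (hvc γ).smul _
  obtain ⟨φ, h0, h1, h01⟩ := exists_continuous_zero_one_of_isClosed hU.isClosed_compl hC (by
    rw [Set.disjoint_compl_left_iff_subset]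
    refine Set.iUnion_subset fun γ => ?_
    rw [Set.smul_set_subset_iff_subset_inv_smul_set, inv_inv]
    exact hvU γ)
  have hpos : ∀ x, 0 < φ x → x ∈ U := fun x hx => by
    by_contra hxU
    exact hx.ne' (h0 hxU)
  refine ⟨φ, t.image fun γ => γ⁻¹, h01, fun γ hγ x hx hγx => ?_, fun x => ?_⟩
  · by_contra hne
    exact Set.disjoint_left.1 (hdisj γ hγ hne) (hpos _ hγx)
      (Set.smul_mem_smul_set (hpos _ hx))
  · obtain ⟨γ, hγ⟩ := Set.mem_iUnion.1 (hv.ge (Set.mem_univ x))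
    exact ⟨(γ : Γ)⁻¹, Finset.mem_image_of_mem _ γ.2,
      h1 (Set.mem_iUnion.2 ⟨γ, Set.smul_mem_smul_set hγ⟩)⟩

theorem strictlyOwns_shift {k : ℕ} (h : (Fin k → ℤ) → ℝ) (z n : Fin k → ℤ) (v : Fin k → ℝ) :
    StrictlyOwns (fun m => h (m + z)) n v ↔ StrictlyOwns h (n + z) fun i => v i + z i := by
  have hd : ∀ m, sqDist (fun i => v i + z i) (m + z) = sqDist v m := by
    intro m
    simp only [sqDist, Pi.add_apply]
    refine Finset.sum_congr rfl fun i _ => ?_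
    push_cast
    ring
  constructor
  · intro H m hm
    have := H (m - z) (fun h => hm (by rw [← h]; simp))
    rw [← hd, ← hd (m - z)] at this
    simpa using this
  · intro H m hm
    have := H (m + z) (fun h => hm (add_right_cancel h))
    rwa [hd, hd] at this

section Tower

variable {k : ℕ} {X : Type*} [MulAction (ZPow k) X]

/-- The weights on `ℤᵏ` along the orbit of `x`. -/
noncomputable def orbitWeights (φ : X → ℝ) (M : ℝ) (x : X) (n : Fin k → ℤ) : ℝ :=
  M * (1 - φ (Multiplicative.ofAdd n • x))

theorem orbitWeights_smul (φ : X → ℝ) (M : ℝ) (x : X) (z : ZPow k) (n : Fin k → ℤ) :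
    orbitWeights φ M (z • x) n = orbitWeights φ M x (n + z.toAdd) := by
  simp only [orbitWeights, smul_smul, ofAdd_add, ofAdd_toAdd]

/-- The base of the tower with shape `box k ℓ`: a site in `ℓℤᵏ` strictly owns the whole box. -/
def towerBase (φ : X → ℝ) (M s : ℝ) (ℓ : ℕ) : Set X :=
  {x | ∃ n : Fin k → ℤ, (∀ i, (ℓ : ℤ) ∣ n i) ∧ ∀ v ∈ intBox k ℓ,
    StrictlyOwns (fun m => s * orbitWeights φ M x m) n fun i => (v i : ℝ)}

/-- Weights lie in `[0, M]`, so only the finitely many sites in `B` can compete with `n`, uniformly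
in `x`; the others lose by distance alone. -/
theorem isOpen_strictlyOwns [TopologicalSpace X]
    [ContinuousConstSMul (ZPow k) X] (φ : C(X, ℝ)) {M s : ℝ}
    (hφ : ∀ x, φ x ∈ Set.Icc (0 : ℝ) 1) (hs : 0 ≤ s) (hM : 0 ≤ M) (n : Fin k → ℤ)
    (v : Fin k → ℝ) :
    IsOpen {x : X | StrictlyOwns (fun m => s * orbitWeights φ M x m) n v} := by
  set B := {m : Fin k → ℤ | sqDist v m ≤ sqDist v n + s * M} with hB
  have hrw : {x : X | StrictlyOwns (fun m => s * orbitWeights φ M x m) n v} =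
      ⋂ m ∈ B, {x : X | m ≠ n → sqDist v n + s * orbitWeights φ M x n <
        sqDist v m + s * orbitWeights φ M x m} := by
    ext x
    simp only [Set.mem_iInter]
    refine ⟨fun h m _ => h m, fun h m hm => ?_⟩
    by_cases hmB : m ∈ B
    · exact h m hmB hm
    · have h1 : sqDist v n + s * M < sqDist v m := not_le.1 hmB
      have h2 : 0 ≤ s * orbitWeights φ M x m :=
        mul_nonneg hs (mul_nonneg hM (by linarith [(hφ (Multiplicative.ofAdd m • x)).2]))
      have h3 : s * orbitWeights φ M x n ≤ s * M := by
        refine mul_le_mul_of_nonneg_left ?_ hs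
        have := (hφ (Multiplicative.ofAdd n • x)).1
        simp only [orbitWeights]
        nlinarith
      linarith
  rw [hrw]
  refine (finite_sqDist_le v _).isOpen_biInter fun m _ => ?_
  by_cases hm : m = n
  · simp [hm]
  · simp only [ne_eq, hm, not_false_eq_true, forall_true_left]
    refine isOpen_lt ?_ ?_ <;> unfold orbitWeights <;> fun_prop

theorem isOpen_towerBase [TopologicalSpace X]
    [ContinuousConstSMul (ZPow k) X] (φ : C(X, ℝ)) {M s : ℝ}
    (hφ : ∀ x, φ x ∈ Set.Icc (0 : ℝ) 1) (hs : 0 ≤ s) (hM : 0 ≤ M) (ℓ : ℕ) :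
    IsOpen (towerBase (k := k) φ M s ℓ : Set X) := by
  have : (towerBase (k := k) φ M s ℓ : Set X) = ⋃ n : Fin k → ℤ, ⋃ _ : ∀ i, (ℓ : ℤ) ∣ n i,
      ⋂ v ∈ intBox k ℓ, {x : X | StrictlyOwns (fun m => s * orbitWeights φ M x m) n
        fun i => (v i : ℝ)} := by
    ext x
    simp [towerBase]
  rw [this]
  exact isOpen_iUnion fun n => isOpen_iUnion fun _ =>
    isOpen_biInter_finset fun v _ => isOpen_strictlyOwns φ hφ hs hM n _

/-- Translating by `γ` carries the point `γ` of the owned box to the origin, so the level is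
recorded by the residue modulo `ℓ` of the owner of the origin. -/
theorem strictlyOwns_of_mem_smul_towerBase {φ : X → ℝ} {M s : ℝ} {ℓ : ℕ} {γ : ZPow k}
    (hγ : γ ∈ box k ℓ) {x : X} (hx : x ∈ γ • (towerBase (k := k) φ M s ℓ : Set X)) :
    ∃ n : Fin k → ℤ, (∀ i, (ℓ : ℤ) ∣ n i + γ.toAdd i) ∧
      StrictlyOwns (fun m => s * orbitWeights φ M x m) n 0 := by
  obtain ⟨y, ⟨n, hn, hown⟩, rfl⟩ := hx
  refine ⟨n - γ.toAdd, fun i => by simpa using hn i, ?_⟩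
  have h1 := hown _ (mem_box.1 hγ)
  simp only [orbitWeights_smul]
  rw [strictlyOwns_shift (fun m => s * orbitWeights φ M y m)]
  convert h1 using 2
  · simp
  · simp

theorem disjoint_smul_towerBase {φ : X → ℝ} {M s : ℝ} {ℓ : ℕ} {γ δ : ZPow k}
    (hγ : γ ∈ box k ℓ) (hδ : δ ∈ box k ℓ) (hne : γ ≠ δ) :
    Disjoint (γ • (towerBase (k := k) φ M s ℓ : Set X)) (δ • towerBase (k := k) φ M s ℓ) := by
  rw [Set.disjoint_left]
  intro x hx hx'
  obtain ⟨n, hn, hown⟩ := strictlyOwns_of_mem_smul_towerBase hγ hx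
  obtain ⟨m, hm, hown'⟩ := strictlyOwns_of_mem_smul_towerBase hδ hx'
  obtain rfl := hown.eq hown'
  refine hne (Multiplicative.toAdd.injective (funext fun i => ?_))
  have h1 := mem_intBox.1 (mem_box.1 hγ) i
  have h2 := mem_intBox.1 (mem_box.1 hδ) i
  have h3 : (ℓ : ℤ) ∣ γ.toAdd i - δ.toAdd i := by
    have := dvd_sub (hn i) (hm i)
    simpa using this
  have h4 := Int.eq_zero_of_abs_lt_dvd h3 (by rw [abs_lt]; constructor <;> linarith)
  linarith

/-- In the grid of boxes of side `ℓ` aligned with the owner `n`, the box containing `z` lies within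
distance `ℓ` of `z`, hence is owned entirely by `n`; the position of `z` in this box is the level.
-/
theorem mem_tower_of_deep {φ : X → ℝ} {M s : ℝ} {ℓ : ℕ} (hℓ : 0 < ℓ) {x : X} {z : Fin k → ℤ}
    (h : ∃ n : Fin k → ℤ, ∀ v : Fin k → ℤ, (∀ i, |v i - z i| ≤ ℓ) →
      StrictlyOwns (fun m => s * orbitWeights φ M x m) n fun i => (v i : ℝ)) :
    Multiplicative.ofAdd z • x ∈ ⋃ γ ∈ box k ℓ, γ • (towerBase (k := k) φ M s ℓ : Set X) := by
  obtain ⟨n, hn⟩ := h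
  have hℓ' : (0 : ℤ) < ℓ := by exact_mod_cast hℓ
  set g : Fin k → ℤ := fun i => (z i - n i) % ℓ with hg
  have hgbox : Multiplicative.ofAdd g ∈ box k ℓ := by
    rw [mem_box, mem_intBox]
    exact fun i => ⟨Int.emod_nonneg _ hℓ'.ne', Int.emod_lt_of_pos _ hℓ'⟩
  refine Set.mem_biUnion hgbox ?_
  rw [Set.mem_smul_set_iff_inv_smul_mem, ← ofAdd_neg, smul_smul, ← ofAdd_add]
  refine ⟨n - (-g + z), fun i => ?_, fun v hv => ?_⟩
  · have := Int.dvd_sub_self_of_emod_eq (a := z i - n i) (b := (ℓ : ℤ)) (c := g i) rfl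
    simp only [Pi.sub_apply, Pi.add_apply, Pi.neg_apply]
    convert this using 1
    ring
  · simp only [orbitWeights_smul]
    rw [strictlyOwns_shift (fun m => s * orbitWeights φ M x m), toAdd_ofAdd, sub_add_cancel]
    have := hn (v + (-g + z)) (fun i => by
      have h1 := mem_intBox.1 hv i
      have h2 := mem_intBox.1 (mem_box.1 hgbox) i
      simp only [toAdd_ofAdd] at h2
      simp only [Pi.add_apply, Pi.neg_apply]
      rw [abs_le]
      constructor <;> linarith)
    convert this using 2
    simp

/-- Weight below `M` means `φ > 0`, which gives separation; weight zero comes from `φ = 1`. The `1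
+` in `hΛ` absorbs rounding `u` to a lattice point. -/
theorem goodWeights_orbitWeights {φ : X → ℝ} {M : ℝ} {r Λ : ℕ}
    (hφ : ∀ x, φ x ∈ Set.Icc (0 : ℝ) 1) (hM : 0 ≤ M)
    (hsep : ∀ γ : ZPow k, (∀ i, |γ.toAdd i| ≤ r) → ∀ x, 0 < φ x → 0 < φ (γ • x) → γ = 1)
    {A : Finset (ZPow k)} (hA : ∀ x, ∃ a ∈ A, φ (a • x) = 1)
    (hΛ : ∀ a ∈ A, ∑ i, (1 + |(a.toAdd i : ℝ)|) ^ 2 ≤ (Λ : ℝ)) (x : X) :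
    GoodWeights (orbitWeights (k := k) φ M x) M Λ r where
  nonneg n := mul_nonneg hM (by linarith [(hφ (Multiplicative.ofAdd n • x)).2])
  le n := by
    have := (hφ (Multiplicative.ofAdd n • x)).1
    simp only [orbitWeights]
    nlinarith
  separated n m hn hm hne := by
    by_contra! hcon
    have hpos : ∀ n : Fin k → ℤ, orbitWeights φ M x n < M → 0 < φ (Multiplicative.ofAdd n • x) := by
      intro n hn
      refine lt_of_le_of_ne (hφ _).1 fun h => ?_
      simp [orbitWeights, ← h] at hn
    refine hne ?_
    have := hsep (Multiplicative.ofAdd (n - m)) (fun i => by simpa using hcon i)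
      (Multiplicative.ofAdd m • x) (hpos m hm)
      (by rw [smul_smul, ← ofAdd_add, sub_add_cancel]; exact hpos n hn)
    exact sub_eq_zero.1 (Multiplicative.ofAdd.injective this)
  dense u := by
    obtain ⟨a, ha, h1⟩ := hA (Multiplicative.ofAdd (fun i => ⌊u i⌋) • x)
    refine ⟨a.toAdd + fun i => ⌊u i⌋, ?_, (Finset.sum_le_sum fun i _ => ?_).trans (hΛ a ha)⟩
    · rw [smul_smul] at h1
      simp [orbitWeights, ofAdd_add, h1]
    · rw [← sq_abs (u i - _)]
      have h2 := Int.fract_nonneg (u i)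
      have h3 := Int.fract_lt_one (u i)
      have h4 : u i - ((a.toAdd + fun i => ⌊u i⌋) i : ℤ) = Int.fract (u i) - a.toAdd i := by
        simp only [Pi.add_apply, Int.cast_add, Int.fract]
        ring
      rw [h4]
      gcongr
      refine (abs_sub _ _).trans ?_
      rw [abs_of_nonneg h2]
      linarith

end Tower

/-- Mass transport: a lower bound for the density of visits along large boxes bounds the measure. -/
theorem measure_ge_of_visits {k : ℕ} {X : Type*} [MeasurableSpace X] [MulAction (ZPow k) X]
    [MeasurableConstSMul (ZPow k) X]
    {μ : Measure X} [IsProbabilityMeasure μ] [SMulInvariantMeasure (ZPow k) X μ] {E : Set X}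
    (hE : MeasurableSet E) {p Λ : ℕ}
    (h : ∀ (T : ℕ) (x : X), (p * T) ^ k ≤ (p + 1) ^ k *
      ((Fintype.piFinset fun _ : Fin k => Finset.Icc (-(Λ : ℤ)) (T + Λ)).filter fun z =>
        Multiplicative.ofAdd z • x ∈ E).card) :
    ((p : ℝ) / (p + 1)) ^ k ≤ μ.real E := by
  have hT : ∀ T : ℕ, ((p : ℝ) * T) ^ k ≤ (p + 1) ^ k * ((T + 2 * Λ + 1) ^ k * μ.real E) := by
    intro T
    set B := Fintype.piFinset fun _ : Fin k => Finset.Icc (-(Λ : ℤ)) (T + Λ) with hB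
    have hBc : (B.card : ℝ) = (T + 2 * Λ + 1) ^ k := by
      rw [hB, Fintype.card_piFinset]
      simp only [Int.card_Icc, Finset.prod_const, Finset.card_univ, Fintype.card_fin]
      have : ((T : ℤ) + Λ + 1 - -Λ).toNat = T + 2 * Λ + 1 := by omega
      rw [this]
      push_cast
      rfl
    have hint : ∀ z ∈ B, Integrable
        (fun x => (E.indicator (fun _ => (1 : ℝ)) (Multiplicative.ofAdd z • x))) μ := by
      intro z _
      have : (fun x => (E.indicator (fun _ => (1 : ℝ)) (Multiplicative.ofAdd z • x))) =
          ((fun x => Multiplicative.ofAdd z • x) ⁻¹' E).indicator fun _ => (1 : ℝ) := rfl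
      rw [this]
      exact (integrable_const _).indicator (measurable_const_smul _ hE)
    have h1 : ∫ x, ∑ z ∈ B, E.indicator (fun _ => (1 : ℝ)) (Multiplicative.ofAdd z • x) ∂μ =
        B.card * μ.real E := by
      rw [integral_finsetSum _ hint, ← nsmul_eq_mul]
      refine Finset.sum_eq_card_nsmul fun z _ => ?_
      have : (fun x => (E.indicator (fun _ => (1 : ℝ)) (Multiplicative.ofAdd z • x))) =
          ((fun x => Multiplicative.ofAdd z • x) ⁻¹' E).indicator fun _ => (1 : ℝ) := rfl
      rw [this, integral_indicator_const _ (measurable_const_smul _ hE), smul_eq_mul, mul_one,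
        measureReal_def, measure_preimage_smul, measureReal_def]
    have h2 : ∫ _ : X, ((p : ℝ) * T) ^ k ∂μ ≤ ∫ x, (p + 1) ^ k *
        ∑ z ∈ B, E.indicator (fun _ => (1 : ℝ)) (Multiplicative.ofAdd z • x) ∂μ := by
      refine integral_mono (integrable_const _) ((integrable_finsetSum _ hint).const_mul _)
        fun x => ?_
      have h3 := h T x
      rw [Finset.card_filter] at h3
      have h4 : ((p : ℝ) * T) ^ k ≤ (p + 1) ^ k *
          ∑ z ∈ B, if Multiplicative.ofAdd z • x ∈ E then (1 : ℝ) else 0 := by exact_mod_cast h3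
      simpa only [Set.indicator_apply] using h4
    rw [integral_const_mul, h1, hBc] at h2
    simpa using h2
  have hlim : Tendsto (fun T : ℕ => ((p : ℝ) / (p + 1)) ^ k * ((T : ℝ) / (T + (2 * Λ + 1))) ^ k)
      atTop (𝓝 (((p : ℝ) / (p + 1)) ^ k * 1 ^ k)) :=
    ((tendsto_natCast_div_add_atTop (2 * (Λ : ℝ) + 1)).pow k).const_mul _
  rw [one_pow, mul_one] at hlim
  refine le_of_tendsto hlim (Eventually.of_forall fun T => ?_)
  have h1 := hT T
  rw [div_pow, div_pow, div_mul_div_comm, div_le_iff₀ (by positivity), ← mul_pow]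
  calc ((p : ℝ) * T) ^ k ≤ _ := h1
    _ = _ := by ring

theorem hasURP_of_hasMarkerProperty {k : ℕ} {X : Type*} [MetricSpace X] [CompactSpace X]
    [MeasurableSpace X] [BorelSpace X] [MulAction (ZPow k) X] [ContinuousConstSMul (ZPow k) X]
    (hX : HasMarkerProperty (ZPow k) X) : HasURP (ZPow k) X := by
  intro K ε hε
  obtain ⟨ℓ, hℓ, hinv⟩ := exists_isInvariantSet_box k K hε
  -- `p / (p + 1)` is the contraction ratio, and its `k`-th power will bound the measure of the
  -- tower from below.
  obtain ⟨p, hp, hpε⟩ : ∃ p : ℕ, 0 < p ∧ 1 - ((p : ℝ) / (p + 1)) ^ k < ε := by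
    have h1 : Tendsto (fun p : ℕ => 1 - ((p : ℝ) / (p + 1)) ^ k) atTop (𝓝 (1 - 1 ^ k)) :=
      ((tendsto_natCast_div_add_atTop (1 : ℝ)).pow k).const_sub 1
    rw [one_pow, sub_self] at h1
    exact ((eventually_gt_atTop 0).and (h1.eventually_lt_const hε)).exists
  have hp' : (0 : ℝ) < p := by exact_mod_cast hp
  set s : ℝ := (p : ℝ) / (p + 1) with hs
  have hs0 : 0 < s := by positivity
  have hs1 : 0 < 1 - s := by
    have : s < 1 := by
      rw [hs, div_lt_one (by positivity)]
      linarith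
    linarith
  set c : ℝ := k * (((ℓ : ℝ) + 1) ^ 2 / (1 - s)) with hc
  have hc0 : 0 ≤ c := by positivity
  -- This gives `(1 - s) r² - 2 (ℓ + 1) r ≥ r (1 + c) > c`. The marker function depends on `r`, `Λ`
  -- on the marker function, and `M` on `Λ`.
  obtain ⟨r, hr⟩ := exists_nat_ge (max 1 ((2 * ((ℓ : ℝ) + 1) + 1 + c) / (1 - s)))
  have hr1 : (1 : ℝ) ≤ r := (le_max_left _ _).trans hr
  have hr2 : 2 * ((ℓ : ℝ) + 1) + 1 + c ≤ (1 - s) * r := by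
    have := (le_max_right _ _).trans hr
    rw [div_le_iff₀ hs1] at this
    linarith
  obtain ⟨φ, A, hφ, hsep, hA⟩ := hX.exists_function
    ((Fintype.piFinset fun _ : Fin k => Finset.Icc (-(r : ℤ)) r).map
      Multiplicative.ofAdd.toEmbedding)
  obtain ⟨Λ, hΛ⟩ := exists_nat_ge (1 + ∑ a ∈ A, ∑ i, (1 + |(a.toAdd i : ℝ)|) ^ 2)
  have hsum0 : ∀ a ∈ A, 0 ≤ ∑ i, (1 + |(a.toAdd i : ℝ)|) ^ 2 := fun a _ =>
    Finset.sum_nonneg fun _ _ => sq_nonneg _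
  have hΛ0 : (0 : ℝ) < Λ := by linarith [Finset.sum_nonneg hsum0]
  have hΛA : ∀ a ∈ A, ∑ i, (1 + |(a.toAdd i : ℝ)|) ^ 2 ≤ (Λ : ℝ) := fun a ha => by
    linarith [Finset.single_le_sum hsum0 ha]
  set M : ℝ := Λ + (c + 1) / s with hM
  have hM0 : 0 ≤ M := by positivity
  have hgood : ∀ x : X, GoodWeights (orbitWeights (k := k) φ M x) M Λ r :=
    goodWeights_orbitWeights hφ hM0 (fun γ hγ x hx hγx => hsep γ (by
      rw [Finset.mem_map_equiv, Fintype.mem_piFinset]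
      exact fun i => Finset.mem_Icc.2 (abs_le.1 (hγ i))) x hx hγx) hA hΛA
  set V : Set X := towerBase (k := k) φ M s ℓ with hV
  have hVo : IsOpen V := isOpen_towerBase φ hφ hs0.le hM0 ℓ
  have hE : IsOpen (⋃ γ ∈ box k ℓ, γ • V) := isOpen_biUnion fun γ _ => hVo.smul γ
  refine ⟨1, fun _ => V, fun _ => box k ℓ, fun _ => hVo, fun _ => hinv, ?_, ?_⟩
  · intro i γ hγ j δ hδ hne
    exact disjoint_smul_towerBase hγ hδ fun h => hne (by rw [h, Subsingleton.elim i j])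
  · rw [Set.iUnion_const]
    refine lt_of_le_of_lt (iSup₂_le fun μ hμ => ?_) ((ENNReal.ofReal_lt_ofReal_iff hε).2 hpε)
    have := hμ.1
    have := hμ.2
    have hcM : MeasurableConstSMul (ZPow k) X := inferInstance
    have key := measure_ge_of_visits (μ := μ) hE.measurableSet (p := p) (Λ := Λ) fun T x => by
      refine (card_deep_ge (ℓ := ℓ) hp (by exact_mod_cast hΛ0) (hgood x) ?_ ?_ ?_ T).trans
        (Nat.mul_le_mul_left _ (Finset.card_le_card ?_))
      · nlinarith
      · nlinarith
      · have : s * (M - Λ) = c + 1 := by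
          rw [hM]
          field_simp
          ring
        linarith
      · exact Finset.monotone_filter_right _ fun z _ hz => mem_tower_of_deep hℓ hz
    rw [← ofReal_measureReal (measure_ne_top μ _), measureReal_compl hE.measurableSet, probReal_univ]
    exact ENNReal.ofReal_le_ofReal (by linarith)

/-- An extension of a free minimal system has the marker property. -/
theorem hasMarkerProperty_of_isFactorMap {Γ X Y : Type*} [Group Γ] [TopologicalSpace X]
    [MetricSpace Y] [MulAction Γ X] [MulAction Γ Y] [ContinuousConstSMul Γ Y] {π : X → Y}
    (hπ : IsFactorMap Γ π) (hfree : IsFreeAction Γ Y) (hmin : MulAction.IsMinimal Γ Y) :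
    HasMarkerProperty Γ X := by
  obtain ⟨hcont, hequiv, _⟩ := hπ
  intro F
  have hpre : ∀ (γ : Γ) (U : Set Y), γ • (π ⁻¹' U) = π ⁻¹' (γ • U) := by
    intro γ U
    ext x
    simp only [Set.mem_smul_set_iff_inv_smul_mem, Set.mem_preimage, hequiv]
  rcases isEmpty_or_nonempty X with hX | ⟨⟨x₀⟩⟩
  · exact ⟨∅, isOpen_empty, fun γ _ _ => by simp, by
      rw [Set.eq_univ_iff_forall]
      exact fun x => hX.elim x⟩
  -- Any point of `Y` would do: by freeness a small neighbourhood of it is disjoint from its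
  -- translates by `F`, and by minimality its translates cover `Y`.
  set y := π x₀
  have hsep : ∀ γ ∈ F, ∃ U : Set Y, IsOpen U ∧ y ∈ U ∧ (γ ≠ 1 → Disjoint U (γ • U)) := by
    intro γ _
    by_cases hγ : γ = 1
    · exact ⟨Set.univ, isOpen_univ, Set.mem_univ _, fun h => absurd hγ h⟩
    · obtain ⟨U, V, hU, hV, hyU, hyV, hUV⟩ := t2_separation fun h : γ • y = y => hγ (hfree γ y h)
      refine ⟨(fun z => γ • z) ⁻¹' U ∩ V, (hU.preimage (continuous_const_smul γ)).inter hV,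
        ⟨hyU, hyV⟩, fun _ => ?_⟩
      rw [Set.disjoint_left]
      rintro z ⟨_, hz⟩ ⟨w, ⟨hw, _⟩, rfl⟩
      exact Set.disjoint_left.1 hUV hw hz
  choose! U hUo hyU hUd using hsep
  set W : Set Y := ⋂ γ ∈ F, U γ with hW
  have hWo : IsOpen W := isOpen_biInter_finset hUo
  have hyW : y ∈ W := Set.mem_iInter₂.2 hyU
  refine ⟨π ⁻¹' W, hWo.preimage hcont, fun γ hγ hne => ?_, ?_⟩
  · rw [hpre]
    refine Disjoint.preimage π ((hUd γ hγ hne).mono ?_ ?_)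
    · exact Set.biInter_subset_of_mem hγ
    · exact Set.smul_set_mono (Set.biInter_subset_of_mem hγ)
  · rw [Set.eq_univ_iff_forall]
    intro x
    obtain ⟨γ, hγ⟩ := hWo.exists_smul_mem Γ (π x) ⟨y, hyW⟩
    refine Set.mem_iUnion.2 ⟨γ⁻¹, ?_⟩
    rw [hpre, Set.mem_preimage, Set.mem_smul_set_iff_inv_smul_mem, inv_inv]
    exact hγ

end Marker

/-! ### Adding and splitting the orders of open covers. -/

section Covers

open scoped Classical NNReal

variable {X : Type*}

theorem ordAt_eq (𝒱 : Finset (Set X)) (x : X) :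
    ordAt 𝒱 x = ((𝒱.filter fun V => x ∈ V).card : ℝ) - 1 := by
  rw [ordAt, Finset.card_filter]
  push_cast
  simp only [Set.indicator_apply]
  ring

theorem ordAt_image_le {ι : Type*} (I : Finset ι) (W : ι → Set X) (x : X) :
    ordAt (I.image W) x ≤ ((I.filter fun i => x ∈ W i).card : ℝ) - 1 := by
  rw [ordAt_eq, Finset.filter_image]
  gcongr
  exact Finset.card_image_le

theorem IsOpenCover.exists_mem [TopologicalSpace X] {𝒱 : Finset (Set X)} (h : IsOpenCover 𝒱)
    (x : X) : ∃ V ∈ 𝒱, x ∈ V := by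
  have := h.2.ge (Set.mem_univ x)
  simpa using this

/-- The functions serve the cover constructions, and their closed supports allow weak limits of
measures to be controlled. -/
theorem IsOpenCover.exists_partition [TopologicalSpace X] [NormalSpace X] {𝒲 : Finset (Set X)}
    (h : IsOpenCover 𝒲) :
    ∃ ρ : Set X → X → ℝ≥0, (∀ w, Continuous (ρ w)) ∧ (∀ w ∈ 𝒲, closure {x | 0 < ρ w x} ⊆ w) ∧
      ∀ x, ∃ w ∈ 𝒲, 0 < ρ w x := by
  obtain ⟨f, hf⟩ := PartitionOfUnity.exists_isSubordinate_of_locallyFinite isClosed_univ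
    (fun w : 𝒲 => (w : Set X)) (fun w => h.1 w w.2) (locallyFinite_of_finite _) (fun x _ => by
      obtain ⟨w, hw, hx⟩ := h.exists_mem x
      exact Set.mem_iUnion.2 ⟨⟨w, hw⟩, hx⟩)
  refine ⟨fun w x => if hw : w ∈ 𝒲 then (f ⟨w, hw⟩ x).toNNReal else 0, fun w => ?_, fun w hw => ?_,
    fun x => ?_⟩
  · by_cases hw : w ∈ 𝒲
    · simp only [hw, dif_pos]
      exact continuous_real_toNNReal.comp (f ⟨w, hw⟩).continuous
    · simp only [hw, dif_neg, not_false_eq_true]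
      exact continuous_const
  · refine Set.Subset.trans (closure_mono fun x hx => ?_) (hf ⟨w, hw⟩)
    simp only [hw, dif_pos, Real.toNNReal_pos, Set.mem_ofPred_eq] at hx
    exact hx.ne'
  · obtain ⟨w, hw⟩ := f.exists_pos (Set.mem_univ x)
    exact ⟨w, w.2, by simpa using hw⟩

/-- Finitely many families of functions, each without common zeros, admit a joint open cover whose
order at a point is at most the sum of the orders of the families at this point. -/
theorem exists_joint_cover [TopologicalSpace X] {ι κ : Type*} (J : Finset ι) (K : ι → Finset κ)
    (f : ι → κ → X → ℝ≥0) (hf : ∀ j k, Continuous (f j k))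
    (hpos : ∀ j ∈ J, ∀ x, ∃ k ∈ K j, 0 < f j k x) :
    ∃ 𝒲 : Finset (Set X), IsOpenCover 𝒲 ∧
      (∀ W ∈ 𝒲, ∀ j ∈ J, ∃ k ∈ K j, ∀ x ∈ W, 0 < f j k x) ∧
      ∀ x, ordAt 𝒲 x ≤ ∑ j ∈ J, ((((K j).filter fun k => 0 < f j k x).card : ℝ) - 1) := by
  -- Dividing by the maximum makes every family attain exactly the value `1`, so that values from
  -- different families can be compared.
  set m : ι → X → ℝ≥0 := fun j x => (K j).sup fun k => f j k x with hm
  have hle : ∀ j, ∀ k ∈ K j, ∀ x, f j k x ≤ m j x := fun j k hk x =>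
    Finset.le_sup (f := fun k => f j k x) hk
  have hmpos : ∀ j ∈ J, ∀ x, 0 < m j x := fun j hj x => by
    obtain ⟨k, hk, h⟩ := hpos j hj x
    exact h.trans_le (hle j k hk x)
  have hmc : ∀ j, Continuous (m j) := fun j => Continuous.finset_sup_apply fun k _ => hf j k
  set I : Finset (Σ _ : ι, κ) := J.sigma K with hI
  set r : (Σ _ : ι, κ) → X → ℝ≥0 := fun a x => f a.1 a.2 x / m a.1 x with hr
  have hIJ : ∀ a ∈ I, a.1 ∈ J ∧ a.2 ∈ K a.1 := fun a ha => Finset.mem_sigma.1 ha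
  have hrc : ∀ a ∈ I, Continuous (r a) := fun a ha =>
    (hf _ _).div₀ (hmc _) fun x => (hmpos _ (hIJ a ha).1 x).ne'
  have hr1 : ∀ a ∈ I, ∀ x, r a x ≤ 1 := fun a ha x =>
    div_le_one_of_le₀ (hle _ _ (hIJ a ha).2 x) zero_le
  have hrpos : ∀ a ∈ I, ∀ x, 0 < r a x ↔ 0 < f a.1 a.2 x := fun a ha x =>
    div_pos_iff_of_pos_right (hmpos _ (hIJ a ha).1 x)
  set W : Finset (Σ _ : ι, κ) → Set X := fun A =>
    {x | (∀ a ∈ A, 0 < r a x) ∧ ∀ a ∈ A, ∀ b ∈ I \ A, r b x < r a x} with hW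
  have hWm : ∀ A x, x ∈ W A ↔
      (∀ a ∈ A, 0 < r a x) ∧ ∀ a ∈ A, ∀ b ∈ I \ A, r b x < r a x := fun _ _ => Iff.rfl
  clear_value W
  -- Meeting every family ensures both the refinement property and `|A| ≥ |J|`, the source of the
  -- `-1` for each family.
  set P := I.powerset.filter fun A => ∀ j ∈ J, ∃ k, (⟨j, k⟩ : Σ _ : ι, κ) ∈ A with hP
  have hPI : ∀ A ∈ P, A ⊆ I := fun A hA => Finset.mem_powerset.1 (Finset.mem_filter.1 hA).1
  refine ⟨P.image W, ⟨?_, ?_⟩, ?_, ?_⟩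
  · intro U hU
    obtain ⟨A, hA, rfl⟩ := Finset.mem_image.1 hU
    have : W A = (⋂ a ∈ A, {x | 0 < r a x}) ∩ ⋂ a ∈ A, ⋂ b ∈ I \ A, {x | r b x < r a x} := by
      ext x
      simp only [hWm, Set.mem_inter_iff, Set.mem_iInter, Set.mem_ofPred_eq]
    rw [this]
    refine (isOpen_biInter_finset fun a ha => ?_).inter
      (isOpen_biInter_finset fun a ha => isOpen_biInter_finset fun b hb => ?_)
    · exact isOpen_lt continuous_const (hrc a (hPI A hA ha))
    · exact isOpen_lt (hrc b (Finset.mem_sdiff.1 hb).1) (hrc a (hPI A hA ha))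
  · rw [Set.eq_univ_iff_forall]
    intro x
    refine Set.mem_biUnion (Finset.mem_image_of_mem W (a := I.filter fun a => r a x = 1) ?_) ?_
    · refine Finset.mem_filter.2 ⟨Finset.mem_powerset.2 (Finset.filter_subset _ _), fun j hj => ?_⟩
      obtain ⟨k₀, hk₀, -⟩ := hpos j hj x
      obtain ⟨k, hk, hkm⟩ := Finset.exists_mem_eq_sup (K j) ⟨k₀, hk₀⟩ fun k => f j k x
      refine ⟨k, Finset.mem_filter.2 ⟨Finset.mem_sigma.2 ⟨hj, hk⟩, ?_⟩⟩
      have : f j k x = m j x := hkm.symm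
      simp only [hr, this]
      exact div_self (hmpos j hj x).ne'
    · refine (hWm _ _).2 ⟨fun a ha => ?_, fun a ha b hb => ?_⟩
      · rw [(Finset.mem_filter.1 ha).2]
        exact one_pos
      · rw [(Finset.mem_filter.1 ha).2]
        simp only [Finset.mem_sdiff, Finset.mem_filter, not_and] at hb
        exact lt_of_le_of_ne (hr1 b hb.1 x) (hb.2 hb.1)
  · intro U hU j hj
    obtain ⟨A, hA, rfl⟩ := Finset.mem_image.1 hU
    obtain ⟨k, hk⟩ := (Finset.mem_filter.1 hA).2 j hj
    have hkI := hPI A hA hk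
    exact ⟨k, (hIJ _ hkI).2, fun x hx => (hrpos _ hkI x).1 (((hWm _ _).1 hx).1 _ hk)⟩
  · intro x
    refine (ordAt_image_le _ _ _).trans ?_
    set S : Finset (Σ _ : ι, κ) := J.sigma fun j => (K j).filter fun k => 0 < f j k x with hS
    -- Two distinct index sets of equal size cannot both be active at `x`: the elements of their two
    -- differences would have to exceed each other. Hence active index sets are determined by their
    -- size.
    have hcard : (P.filter fun A => x ∈ W A).card ≤ (Finset.Icc J.card S.card).card := by
      refine Finset.card_le_card_of_injOn Finset.card (fun A hA => ?_) (fun A hA B hB hAB => ?_)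
      · obtain ⟨hA, hxA⟩ := Finset.mem_filter.1 hA
        rw [hWm] at hxA
        simp only [Finset.coe_Icc, Set.mem_Icc]
        constructor
        · have : J ⊆ A.image Sigma.fst := fun j hj => by
            obtain ⟨k, hk⟩ := (Finset.mem_filter.1 hA).2 j hj
            exact Finset.mem_image.2 ⟨_, hk, rfl⟩
          exact (Finset.card_le_card this).trans Finset.card_image_le
        · refine Finset.card_le_card fun a ha => ?_
          have haI := hPI A hA ha
          exact Finset.mem_sigma.2 ⟨(hIJ a haI).1, Finset.mem_filter.2
            ⟨(hIJ a haI).2, (hrpos a haI x).1 (hxA.1 a ha)⟩⟩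
      · obtain ⟨hA, hxA⟩ := Finset.mem_filter.1 hA
        rw [hWm] at hxA
        obtain ⟨hB, hxB⟩ := Finset.mem_filter.1 hB
        rw [hWm] at hxB
        refine Finset.eq_of_subset_of_card_le (fun a ha => ?_) hAB.ge
        by_contra haB
        obtain ⟨b, hb, hbA⟩ : ∃ b ∈ B, b ∉ A := by
          by_contra! hcon
          have := Finset.eq_of_subset_of_card_le hcon hAB.le
          exact haB (this ▸ ha)
        exact lt_asymm (hxA.2 a ha b (Finset.mem_sdiff.2 ⟨hPI B hB hb, hbA⟩))
          (hxB.2 b hb a (Finset.mem_sdiff.2 ⟨hPI A hA ha, haB⟩))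
    have hScard : S.card = ∑ j ∈ J, ((K j).filter fun k => 0 < f j k x).card :=
      Finset.card_sigma _ _
    have hJS : J.card ≤ S.card := by
      rw [hScard, Finset.card_eq_sum_ones]
      refine Finset.sum_le_sum fun j hj => ?_
      obtain ⟨k, hk, h⟩ := hpos j hj x
      exact Finset.card_pos.2 ⟨k, Finset.mem_filter.2 ⟨hk, h⟩⟩
    rw [Nat.card_Icc] at hcard
    have h1 : (P.filter fun A => x ∈ W A).card + J.card ≤ S.card + 1 := by omega
    have h2 : ((P.filter fun A => x ∈ W A).card : ℝ) + J.card ≤ S.card + 1 := by exact_mod_cast h1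
    rw [Finset.sum_sub_distrib, ← Nat.cast_sum, ← hScard]
    simp only [Finset.sum_const, nsmul_eq_mul, mul_one]
    linarith

/-- The linear map which sends potentials on the two sides of a bipartite graph with edge set `E`
to their differences along the edges. -/
def edgeDiff {α β : Type*} (E : Finset (α × β)) : ((α → ℝ) × (β → ℝ)) →ₗ[ℝ] (E → ℝ) where
  toFun p e := p.1 e.1.1 - p.2 e.1.2
  map_add' p q := by
    ext e
    simp only [Prod.fst_add, Prod.snd_add, Pi.add_apply]
    ring
  map_smul' c p := by
    ext e
    simp only [Prod.smul_fst, Prod.smul_snd, Pi.smul_apply, smul_eq_mul, RingHom.id_apply]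
    ring

/-- Adding one constant to all potentials changes no difference, so the range has dimension at most
`|N| + |S| - 1`. -/
theorem range_edgeDiff_ne_top {α β : Type*} {N : Finset α} {S : Finset β} {E : Finset (α × β)}
    (hE : E ⊆ N ×ˢ S) (hS : S.Nonempty) (hcard : N.card + S.card ≤ E.card) :
    LinearMap.range (edgeDiff E) ≠ ⊤ := by
  have hN : ∀ e : E, e.1.1 ∈ N := fun e => (Finset.mem_product.1 (hE e.2)).1
  have hS' : ∀ e : E, e.1.2 ∈ S := fun e => (Finset.mem_product.1 (hE e.2)).2
  let L : ((N → ℝ) × (S → ℝ)) →ₗ[ℝ] (E → ℝ) :=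
    { toFun := fun p e => p.1 ⟨_, hN e⟩ - p.2 ⟨_, hS' e⟩
      map_add' := fun p q => by
        ext e
        simp only [Prod.fst_add, Prod.snd_add, Pi.add_apply]
        ring
      map_smul' := fun c p => by
        ext e
        simp only [Prod.smul_fst, Prod.smul_snd, Pi.smul_apply, smul_eq_mul, RingHom.id_apply]
        ring }
  intro htop
  have hL : LinearMap.range L = ⊤ := by
    rw [eq_top_iff, ← htop]
    rintro _ ⟨p, rfl⟩
    exact ⟨(fun n => p.1 n, fun w => p.2 w), rfl⟩
  have h1 := LinearMap.finrank_range_add_finrank_ker L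
  rw [hL, finrank_top, Module.finrank_prod, Module.finrank_fintype_fun_eq_card,
    Module.finrank_fintype_fun_eq_card, Module.finrank_fintype_fun_eq_card, Fintype.card_coe,
    Fintype.card_coe, Fintype.card_coe] at h1
  have h2 : 0 < Module.finrank ℝ (LinearMap.ker L) := by
    rw [Module.finrank_pos_iff_exists_ne_zero]
    obtain ⟨w, hw⟩ := hS
    refine ⟨⟨(fun _ => 1, fun _ => 1), by
      rw [LinearMap.mem_ker]
      ext e
      simp [L]⟩, fun h => ?_⟩
    have := congrFun (congrArg Prod.snd (congrArg Subtype.val h)) ⟨w, hw⟩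
    simp at this
  omega

/-- Generic edge weights of a complete bipartite graph are uniformly far from the differences of
potentials on every subgraph with at least as many edges as vertices. -/
theorem exists_generic_weights {α β : Type*} (N : Finset α) (W : Finset β) :
    ∃ (b : α × β → ℝ) (δ : ℝ), 0 < δ ∧ ∀ S ⊆ W, S.Nonempty → ∀ E ⊆ N ×ˢ S,
      N.card + S.card ≤ E.card → ∀ (z : α → ℝ) (y : β → ℝ),
        ∃ e ∈ E, δ ≤ |b e - (z e.1 - y e.2)| := by
  set 𝓔 := (N ×ˢ W).powerset.filter fun E => LinearMap.range (edgeDiff E) ≠ ⊤ with h𝓔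
  set q : Finset (α × β) → Submodule ℝ (α × β → ℝ) := fun E =>
    (LinearMap.range (edgeDiff E)).comap (LinearMap.funLeft ℝ ℝ (Subtype.val : E → α × β)) with hq
  have hqtop : ∀ E ∈ 𝓔, q E ≠ ⊤ := by
    intro E hE htop
    refine (Finset.mem_filter.1 hE).2 (eq_top_iff.2 fun g _ => ?_)
    obtain ⟨b, rfl⟩ := LinearMap.funLeft_surjective_of_injective ℝ ℝ _
      (Subtype.val_injective (p := fun e => e ∈ E)) g
    have : b ∈ q E := htop ▸ Submodule.mem_top
    exact this
  -- Finitely many proper subspaces do not fill a real vector space; as the ranges are closed, a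
  -- point avoiding them has positive distance from each.
  have hne := Subspace.biUnion_ne_univ_of_top_notMem (s := 𝓔.image q) fun h => by
    obtain ⟨E, hE, h⟩ := Finset.mem_image.1 h
    exact hqtop E hE h
  obtain ⟨b, hb⟩ := (Set.ne_univ_iff_exists_notMem _).1 hne
  have hbE : ∀ E ∈ 𝓔, (fun e : E => b e) ∉ LinearMap.range (edgeDiff E) := by
    intro E hE hmem
    exact hb (Set.mem_biUnion (Finset.mem_image_of_mem q hE) hmem)
  have hδ : ∀ E ∈ 𝓔, ∃ δ : ℝ, 0 < δ ∧ ∀ (z : α → ℝ) (y : β → ℝ),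
      ∃ e ∈ E, δ ≤ |b e - (z e.1 - y e.2)| := by
    intro E hE
    have hclosed : IsClosed (LinearMap.range (edgeDiff E) : Set (E → ℝ)) :=
      Submodule.closed_of_finiteDimensional _
    obtain ⟨δ, hδ, hball⟩ := Metric.isOpen_iff.1 hclosed.isOpen_compl _ (hbE E hE)
    refine ⟨δ, hδ, fun z y => ?_⟩
    by_contra! hcon
    refine hball (a := edgeDiff E (z, y)) ?_ ⟨_, rfl⟩
    rw [Metric.mem_ball, dist_comm, dist_pi_lt_iff hδ]
    exact fun e => hcon e e.2
  choose! δ hδpos hδ using hδ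
  obtain ⟨δ₀, hδ₀, hle⟩ : ∃ δ₀ : ℝ, 0 < δ₀ ∧ ∀ E ∈ 𝓔, δ₀ ≤ δ E := by
    rcases 𝓔.eq_empty_or_nonempty with h | h
    · exact ⟨1, one_pos, by simp [h]⟩
    · exact ⟨𝓔.inf' h δ, (Finset.lt_inf'_iff h).2 hδpos, fun E hE => Finset.inf'_le _ hE⟩
  refine ⟨b, δ₀, hδ₀, fun S hS hSne E hE hcard z y => ?_⟩
  have hmem : E ∈ 𝓔 := Finset.mem_filter.2
    ⟨Finset.mem_powerset.2 (hE.trans (Finset.product_subset_product_right hS)),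
      range_edgeDiff_ne_top hE hSne hcard⟩
  obtain ⟨e, he, h⟩ := hδ E hmem z y
  exact ⟨e, he, (hle E hmem).trans h⟩

/-- A finite open cover has arbitrarily many refinements whose orders add up at every point to at
most the order of the given cover. -/
theorem IsOpenCover.exists_split [TopologicalSpace X] [NormalSpace X] {𝒲 : Finset (Set X)}
    (h : IsOpenCover 𝒲) {ι : Type*} (N : Finset ι) :
    ∃ V : ι → Set X → Set X, (∀ n, ∀ w ∈ 𝒲, IsOpen (V n w) ∧ V n w ⊆ w) ∧
      (∀ n x, ∃ w ∈ 𝒲, x ∈ V n w) ∧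
      ∀ x, ∑ n ∈ N, (((𝒲.filter fun w => x ∈ V n w).card : ℝ) - 1) ≤ ordAt 𝒲 x := by
  obtain ⟨ρ, hρc, hρs, hρp⟩ := h.exists_partition
  obtain ⟨b, δ, hδ, hb⟩ := exists_generic_weights N 𝒲
  -- For each `n`, those `w` whose reweighted value `exp (b (n, w)) * ρ w x` is maximal up to the
  -- factor `exp δ`.
  set V : ι → Set X → Set X := fun n w => {x | 0 < ρ w x ∧ ∀ w' ∈ 𝒲,
    Real.exp (b (n, w')) * ρ w' x < Real.exp δ * (Real.exp (b (n, w)) * ρ w x)} with hV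
  have hVm : ∀ n w x, x ∈ V n w ↔ 0 < ρ w x ∧ ∀ w' ∈ 𝒲,
    Real.exp (b (n, w')) * ρ w' x < Real.exp δ * (Real.exp (b (n, w)) * ρ w x) :=
    fun _ _ _ => Iff.rfl
  clear_value V
  have hmax : ∀ n x, ∃ w ∈ 𝒲, 0 < ρ w x ∧ ∀ w' ∈ 𝒲,
      Real.exp (b (n, w')) * ρ w' x ≤ Real.exp (b (n, w)) * ρ w x := by
    intro n x
    obtain ⟨w₀, hw₀, hpos⟩ := hρp x
    obtain ⟨w, hw, hwmax⟩ := Finset.exists_max_image 𝒲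
      (fun w => Real.exp (b (n, w)) * (ρ w x : ℝ)) ⟨w₀, hw₀⟩
    refine ⟨w, hw, ?_, hwmax⟩
    have h1 : 0 < Real.exp (b (n, w₀)) * (ρ w₀ x : ℝ) :=
      mul_pos (Real.exp_pos _) (by exact_mod_cast hpos)
    have h2 := h1.trans_le (hwmax w₀ hw₀)
    exact_mod_cast pos_of_mul_pos_right h2 (Real.exp_pos _).le
  refine ⟨V, fun n w hw => ⟨?_, fun x hx => hρs w hw (subset_closure ((hVm _ _ _).1 hx).1)⟩, fun n x => ?_,
    fun x => ?_⟩
  · have : V n w = {x | 0 < ρ w x} ∩ ⋂ w' ∈ 𝒲, {x | Real.exp (b (n, w')) * (ρ w' x : ℝ) <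
        Real.exp δ * (Real.exp (b (n, w)) * ρ w x)} := by
      ext x
      simp [hVm]
    rw [this]
    refine (isOpen_lt continuous_const (hρc w)).inter (isOpen_biInter_finset fun w' _ => ?_)
    have h1 : ∀ w, Continuous fun x => (ρ w x : ℝ) := fun w =>
      NNReal.continuous_coe.comp (hρc w)
    exact isOpen_lt ((h1 w').const_mul _) (((h1 w).const_mul _).const_mul _)
  · obtain ⟨w, hw, hpos, hle⟩ := hmax n x
    refine ⟨w, hw, (hVm _ _ _).2 ⟨hpos, fun w' hw' => (hle w' hw').trans_lt ?_⟩⟩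
    have h1 : 0 < Real.exp (b (n, w)) * (ρ w x : ℝ) :=
      mul_pos (Real.exp_pos _) (by exact_mod_cast hpos)
    exact lt_mul_of_one_lt_left h1 (Real.one_lt_exp_iff.2 hδ)
  · set S := 𝒲.filter fun w => 0 < ρ w x with hS
    set E := (N ×ˢ 𝒲).filter fun e => x ∈ V e.1 e.2 with hE
    have hEcard : E.card = ∑ n ∈ N, (𝒲.filter fun w => x ∈ V n w).card := by
      rw [hE, Finset.card_filter, Finset.sum_product]
      exact Finset.sum_congr rfl fun n _ => (Finset.card_filter _ _).symm
    have hSne : S.Nonempty := by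
      obtain ⟨w, hw, hpos⟩ := hρp x
      exact ⟨w, Finset.mem_filter.2 ⟨hw, hpos⟩⟩
    have hES : E ⊆ N ×ˢ S := by
      intro e he
      obtain ⟨h1, h2⟩ := Finset.mem_filter.1 he
      rw [hVm] at h2
      obtain ⟨h3, h4⟩ := Finset.mem_product.1 h1
      exact Finset.mem_product.2 ⟨h3, Finset.mem_filter.2 ⟨h4, h2.1⟩⟩
    -- For an edge `(n, w)`, the number `b (n, w) + log ρ_w` is within `δ` of its maximum over `w`,
    -- which depends only on `n`. So on all edges `b` is `δ`-close to a difference of potentials,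
    -- which genericity forbids if there are too many edges.
    have hlt : E.card < N.card + S.card := by
      by_contra! hcon
      choose w hw hwpos hwmax using fun n => hmax n x
      obtain ⟨e, he, hcontra⟩ := hb S (Finset.filter_subset _ _) hSne E hES hcon
        (fun n => b (n, w n) + Real.log (ρ (w n) x)) (fun w => Real.log (ρ w x))
      obtain ⟨he1, he2⟩ := Finset.mem_filter.1 he
      rw [hVm] at he2
      have hpe : (0 : ℝ) < ρ e.2 x := by exact_mod_cast he2.1
      have hpw : (0 : ℝ) < ρ (w e.1) x := by exact_mod_cast hwpos e.1
      have hlog : ∀ (t : ℝ) (p : ℝ), 0 < p → Real.log (Real.exp t * p) = t + Real.log p := by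
        intro t p hp
        rw [Real.log_mul (Real.exp_pos _).ne' hp.ne', Real.log_exp]
      have h1 := Real.log_le_log (mul_pos (Real.exp_pos _) hpe)
        (hwmax e.1 e.2 (Finset.mem_product.1 he1).2)
      have h2 := Real.log_lt_log (mul_pos (Real.exp_pos _) hpw) (he2.2 (w e.1) (hw e.1))
      rw [hlog _ _ hpe, hlog _ _ hpw] at h1
      rw [hlog _ _ (mul_pos (Real.exp_pos _) hpe), hlog _ _ hpe, hlog _ _ hpw] at h2
      refine absurd hcontra (not_le.2 ?_)
      rw [abs_lt]
      constructor <;> linarith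
    have hSle : S.card ≤ (𝒲.filter fun w => x ∈ w).card := by
      refine Finset.card_le_card fun w hw => ?_
      obtain ⟨h1, h2⟩ := Finset.mem_filter.1 hw
      exact Finset.mem_filter.2 ⟨h1, hρs w h1 (subset_closure h2)⟩
    have hfin : E.card + 1 ≤ N.card + (𝒲.filter fun w => x ∈ w).card := by omega
    have hfin' : (E.card : ℝ) + 1 ≤ N.card + (𝒲.filter fun w => x ∈ w).card := by
      exact_mod_cast hfin
    rw [ordAt_eq, Finset.sum_sub_distrib, ← Nat.cast_sum, ← hEcard]
    simp only [Finset.sum_const, nsmul_eq_mul, mul_one]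
    linarith

end Covers

/-! ### Invariant measures as limits of empirical measures. -/

section InvariantMeasures

open scoped Classical BoundedContinuousFunction

variable {Γ : Type*} [Group Γ] {X : Type*} [MulAction Γ X]

theorem abs_sum_sub_sum_le {α : Type*} (A B : Finset α) (f : α → ℝ) {M : ℝ}
    (hf : ∀ a, |f a| ≤ M) : |∑ a ∈ A, f a - ∑ a ∈ B, f a| ≤ M * (A ∆ B).card := by
  have h1 : ∑ a ∈ A, f a - ∑ a ∈ B, f a = ∑ a ∈ A \ B, f a - ∑ a ∈ B \ A, f a := by
    rw [← Finset.sum_sdiff_sub_sum_sdiff]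
  have h2 : ∀ C : Finset α, |∑ a ∈ C, f a| ≤ M * C.card := by
    intro C
    refine (Finset.abs_sum_le_sum_abs _ _).trans ?_
    rw [mul_comm, ← nsmul_eq_mul]
    exact Finset.sum_le_card_nsmul _ _ _ fun a _ => hf a
  have h3 : (A ∆ B).card = (A \ B).card + (B \ A).card := by
    rw [symmDiff_def, Finset.sup_eq_union, Finset.card_union_of_disjoint]
    exact disjoint_sdiff_sdiff
  rw [h1, h3]
  push_cast
  have := abs_sub (∑ a ∈ A \ B, f a) (∑ a ∈ B \ A, f a)
  linarith [h2 (A \ B), h2 (B \ A)]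

/-- The empirical measure of `x` along the inverses of the elements of `F`. -/
noncomputable def empirical [MeasurableSpace X] (F : Finset Γ) (x : X) : Measure X :=
  (F.card : ℝ≥0∞)⁻¹ • ∑ γ ∈ F, Measure.dirac (γ⁻¹ • x)

theorem isProbabilityMeasure_empirical [MeasurableSpace X] {F : Finset Γ} (hF : F.Nonempty)
    (x : X) : IsProbabilityMeasure (empirical F x) := by
  constructor
  have : (F.card : ℝ≥0∞) ≠ 0 := by exact_mod_cast hF.card_pos.ne'
  simp only [empirical, Measure.smul_apply, Measure.finsetSum_apply, measure_univ,
    Finset.sum_const, nsmul_eq_mul, mul_one, smul_eq_mul]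
  exact ENNReal.inv_mul_cancel this (ENNReal.natCast_ne_top _)

theorem empirical_real_apply [MeasurableSpace X] (F : Finset Γ) (x : X) {s : Set X}
    (hs : MeasurableSet s) :
    (empirical F x).real s = (F.card : ℝ)⁻¹ * (F.filter fun γ => γ⁻¹ • x ∈ s).card := by
  have : ∑ γ ∈ F, (Measure.dirac (γ⁻¹ • x)) s =
      ((F.filter fun γ => γ⁻¹ • x ∈ s).card : ℝ≥0∞) := by
    rw [Finset.card_filter]
    push_cast
    refine Finset.sum_congr rfl fun γ _ => ?_
    rw [Measure.dirac_apply' _ hs, Set.indicator_apply]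
    rfl
  rw [measureReal_def, empirical, Measure.smul_apply, Measure.finsetSum_apply, this]
  simp

theorem integral_empirical [TopologicalSpace X] [MeasurableSpace X] [BorelSpace X]
    (F : Finset Γ) (x : X) (f : X →ᵇ ℝ) :
    ∫ y, f y ∂(empirical F x) = (F.card : ℝ)⁻¹ * ∑ γ ∈ F, f (γ⁻¹ • x) := by
  have hm : StronglyMeasurable f := f.continuous.measurable.stronglyMeasurable
  rw [empirical, integral_smul_measure, integral_finsetSum_measure]
  · simp [integral_dirac' _ _ hm]
  · exact fun γ _ => f.integrable _

/-- Since `δ γ⁻¹ = (γ δ⁻¹)⁻¹`, moving the function by `δ` replaces `F n` by its right translate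
under `δ⁻¹`. -/
theorem tendsto_integral_empirical_sub [TopologicalSpace X] [MeasurableSpace X] [BorelSpace X]
    [ContinuousConstSMul Γ X] {F : ℕ → Finset Γ} (hF : IsFolnerSeq F) (x : ℕ → X) (δ : Γ)
    (f : X →ᵇ ℝ) :
    Tendsto (fun n => ∫ y, f (δ • y) ∂(empirical (F n) (x n)) - ∫ y, f y ∂(empirical (F n) (x n)))
      atTop (𝓝 0) := by
  have h1 := (hF.2 δ⁻¹).const_mul ‖f‖
  rw [mul_zero] at h1
  refine squeeze_zero_norm (fun n => ?_) h1
  set g : X →ᵇ ℝ := f.compContinuous ⟨fun y => δ • y, continuous_const_smul δ⟩ with hg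
  have h2 : ∫ y, f (δ • y) ∂(empirical (F n) (x n)) = ∫ y, g y ∂(empirical (F n) (x n)) := rfl
  have h3 : ∑ γ ∈ F n, g (γ⁻¹ • x n) =
      ∑ γ ∈ (F n).image (fun γ => γ * δ⁻¹), f (γ⁻¹ • x n) := by
    rw [Finset.sum_image fun a _ b _ h => mul_right_cancel h]
    refine Finset.sum_congr rfl fun γ _ => ?_
    rw [mul_inv_rev, inv_inv, mul_smul]
    rfl
  rw [h2, integral_empirical, integral_empirical, h3, ← mul_sub, Real.norm_eq_abs, abs_mul,
    abs_of_nonneg (by positivity), mul_div_assoc', div_eq_inv_mul]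
  refine mul_le_mul_of_nonneg_left ?_ (by positivity)
  convert abs_sum_sub_sum_le ((F n).image (fun γ => γ * δ⁻¹)) (F n) (fun γ => f (γ⁻¹ • x n))
    (M := ‖f‖) fun γ => f.norm_coe_le_norm _

theorem smulInvariantMeasure_of_integral_eq [TopologicalSpace X] [MeasurableSpace X]
    [BorelSpace X] [HasOuterApproxClosed X] [ContinuousConstSMul Γ X] {μ : Measure X}
    [IsProbabilityMeasure μ]
    (h : ∀ (δ : Γ) (f : X →ᵇ ℝ), ∫ y, f (δ • y) ∂μ = ∫ y, f y ∂μ) :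
    SMulInvariantMeasure Γ X μ := by
  constructor
  intro δ s hs
  have hm : Measurable fun y : X => δ • y := (continuous_const_smul δ).measurable
  have : IsProbabilityMeasure (μ.map fun y => δ • y) :=
    Measure.isProbabilityMeasure_map hm.aemeasurable
  have heq : μ.map (fun y => δ • y) = μ := by
    refine ext_of_forall_integral_eq_of_IsFiniteMeasure fun f => ?_
    rw [integral_map hm.aemeasurable f.continuous.measurable.aestronglyMeasurable]
    exact h δ f
  rw [← Measure.map_apply hm hs, heq]

variable [MetricSpace X] [CompactSpace X] [MeasurableSpace X] [BorelSpace X]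
  [ContinuousConstSMul Γ X]

/-- A finite family of closed sets which has small total mass with respect to all invariant
measures is uniformly rarely visited along a Følner sequence. -/
theorem eventually_card_visits_le {F : ℕ → Finset Γ} (hF : IsFolnerSeq F) {ι : Type*}
    (J : Finset ι) {C : ι → Set X} (hC : ∀ j ∈ J, IsClosed (C j)) {c : ℝ}
    (hc : ∀ μ ∈ invariantProb Γ X, ∑ j ∈ J, μ.real (C j) < c) :
    ∀ᶠ n in atTop, ∀ x : X,
      ∑ γ ∈ F n, ((J.filter fun j => γ⁻¹ • x ∈ C j).card : ℝ) ≤ c * (F n).card := by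
  by_contra hcon
  rw [not_eventually] at hcon
  set P : Set ℕ := {n | ¬ ∀ x : X,
    ∑ γ ∈ F n, ((J.filter fun j => γ⁻¹ • x ∈ C j).card : ℝ) ≤ c * (F n).card} with hP
  obtain ⟨n₀, hn₀⟩ := hcon.exists
  push Not at hn₀
  obtain ⟨x₀, -⟩ := hn₀
  have hx : ∀ n, ∃ x : X, n ∈ P →
      c * (F n).card < ∑ γ ∈ F n, ((J.filter fun j => γ⁻¹ • x ∈ C j).card : ℝ) := by
    intro n
    by_cases hn : n ∈ P
    · have hn' := hn
      simp only [hP, Set.mem_ofPred_eq, not_forall, not_le] at hn'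
      obtain ⟨x, hx⟩ := hn'
      exact ⟨x, fun _ => hx⟩
    · exact ⟨x₀, fun h => absurd h hn⟩
  choose x hx using hx
  have : NeBot (atTop ⊓ 𝓟 P) := frequently_iff_neBot.1 hcon
  -- An ultrafilter on the bad indices yields a limit measure by compactness; it is invariant, and
  -- the portmanteau inequality for closed sets contradicts the choice of the bad points.
  set U : Ultrafilter ℕ := Ultrafilter.of (atTop ⊓ 𝓟 P) with hU
  have hUle : (U : Filter ℕ) ≤ atTop ⊓ 𝓟 P := Ultrafilter.of_le _
  have hUtop : (U : Filter ℕ) ≤ atTop := hUle.trans inf_le_left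
  have hUP : ∀ᶠ n in (U : Filter ℕ), n ∈ P := hUle (mem_inf_of_right (mem_principal_self P))
  set ν : ℕ → ProbabilityMeasure X := fun n =>
    ⟨empirical (F n) (x n), isProbabilityMeasure_empirical (hF.1 n) (x n)⟩ with hν
  obtain ⟨μ, -, hμ⟩ := isCompact_univ.ultrafilter_le_nhds (U.map ν) (by simp)
  have hlim : Tendsto ν U (𝓝 μ) := hμ
  have hint := ProbabilityMeasure.tendsto_iff_forall_integral_tendsto.1 hlim
  have hinv : SMulInvariantMeasure Γ X (μ : Measure X) := by
    refine smulInvariantMeasure_of_integral_eq fun δ f => ?_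
    have h1 := hint (f.compContinuous ⟨fun y => δ • y, continuous_const_smul δ⟩)
    have h2 := (tendsto_integral_empirical_sub hF x δ f).mono_left hUtop
    exact sub_eq_zero.1 (tendsto_nhds_unique (h1.sub (hint f)) h2)
  have hμc := hc μ ⟨inferInstance, hinv⟩
  obtain ⟨η, hη, hηc⟩ : ∃ η : ℝ, 0 < η ∧ ∑ j ∈ J, ((μ : Measure X).real (C j) + η) < c := by
    refine ⟨(c - ∑ j ∈ J, (μ : Measure X).real (C j)) / (J.card + 1), ?_, ?_⟩
    · exact div_pos (by linarith) (by positivity)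
    · rw [Finset.sum_add_distrib, Finset.sum_const, nsmul_eq_mul, mul_div_assoc']
      have : (J.card : ℝ) * (c - ∑ j ∈ J, (μ : Measure X).real (C j)) / (J.card + 1) <
          c - ∑ j ∈ J, (μ : Measure X).real (C j) := by
        rw [div_lt_iff₀ (by positivity)]
        nlinarith
      linarith
  have hev : ∀ j ∈ J, ∀ᶠ n in (U : Filter ℕ),
      (empirical (F n) (x n)).real (C j) ≤ (μ : Measure X).real (C j) + η := by
    intro j hj
    have h1 := ProbabilityMeasure.limsup_measure_closed_le_of_tendsto hlim (hC j hj)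
    have h2 : (μ : Measure X) (C j) < ENNReal.ofReal ((μ : Measure X).real (C j) + η) := by
      rw [← ofReal_measureReal (measure_ne_top _ _)]
      exact (ENNReal.ofReal_lt_ofReal_iff (by positivity)).2 (by linarith)
    filter_upwards [eventually_lt_of_limsup_lt (h1.trans_lt h2)] with n hn
    exact ENNReal.toReal_le_of_le_ofReal (by positivity) hn.le
  obtain ⟨n, hn, hnP⟩ := (((Finset.eventually_all J).2 hev).and hUP).exists
  have h1 := hx n hnP
  have hpos : (0 : ℝ) < (F n).card := by exact_mod_cast (hF.1 n).card_pos
  have h2 : ∑ γ ∈ F n, ((J.filter fun j => γ⁻¹ • x n ∈ C j).card : ℝ) =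
      (F n).card * ∑ j ∈ J, (empirical (F n) (x n)).real (C j) := by
    have h3 : ∀ j ∈ J, (empirical (F n) (x n)).real (C j) =
        ((F n).card : ℝ)⁻¹ * ∑ γ ∈ F n, if γ⁻¹ • x n ∈ C j then (1 : ℝ) else 0 := by
      intro j hj
      rw [empirical_real_apply _ _ (hC j hj).measurableSet, Finset.card_filter]
      push_cast
      rfl
    rw [Finset.sum_congr rfl h3, ← Finset.mul_sum, ← mul_assoc, mul_inv_cancel₀ hpos.ne', one_mul,
      Finset.sum_comm]
    refine Finset.sum_congr rfl fun γ _ => ?_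
    rw [Finset.card_filter]
    push_cast
    rfl
  rw [h2] at h1
  have h3 := Finset.sum_le_sum hn
  nlinarith

-- By invariance the number of visits has integral `|F|` times the measure of `O`.
omit [MetricSpace X] [CompactSpace X] [BorelSpace X] [ContinuousConstSMul Γ X] in
theorem measureReal_le_of_card_visits_le [MeasurableConstSMul Γ X] {μ : Measure X}
    (hμ : μ ∈ invariantProb Γ X)
    {F : Finset Γ} (hF : F.Nonempty) {O : Set X} (hO : MeasurableSet O) {c : ℝ}
    (h : ∀ x : X, ((F.filter fun γ => γ⁻¹ • x ∈ O).card : ℝ) ≤ c * F.card) : μ.real O ≤ c := by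
  have := hμ.1
  have := hμ.2
  have hpos : (0 : ℝ) < F.card := by exact_mod_cast hF.card_pos
  have hrw : ∀ γ : Γ, (fun x => if γ⁻¹ • x ∈ O then (1 : ℝ) else 0) =
      ((fun x => γ⁻¹ • x) ⁻¹' O).indicator fun _ => (1 : ℝ) := by
    intro γ
    ext x
    simp only [Set.indicator_apply, Set.mem_preimage]
  have hint : ∀ γ ∈ F, Integrable (fun x => if γ⁻¹ • x ∈ O then (1 : ℝ) else 0) μ := by
    intro γ _
    rw [hrw]
    exact (integrable_const _).indicator (measurable_const_smul _ hO)
  have h1 : ∫ x, ∑ γ ∈ F, (if γ⁻¹ • x ∈ O then (1 : ℝ) else 0) ∂μ = F.card * μ.real O := by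
    rw [integral_finsetSum _ hint, ← nsmul_eq_mul]
    refine Finset.sum_eq_card_nsmul fun γ _ => ?_
    rw [hrw, integral_indicator_const _ (measurable_const_smul _ hO), smul_eq_mul, mul_one,
      measureReal_def, measure_preimage_smul, measureReal_def]
  have h2 : ∫ x, ∑ γ ∈ F, (if γ⁻¹ • x ∈ O then (1 : ℝ) else 0) ∂μ ≤ ∫ _, c * F.card ∂μ := by
    refine integral_mono (integrable_finsetSum _ hint) (integrable_const _) fun x => ?_
    have := h x
    rw [Finset.card_filter] at this
    push_cast at this
    exact this
  rw [h1] at h2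
  simp only [integral_const, probReal_univ, one_smul] at h2
  nlinarith

/-- A closed set of small capacity has an open neighbourhood of small capacity. -/
theorem exists_isOpen_capacity_le (hΓ : IsAmenable Γ) {C : Set X} (hC : IsClosed C) {c : ℝ}
    (hc : ∀ μ ∈ invariantProb Γ X, μ.real C < c) :
    ∃ O : Set X, IsOpen O ∧ C ⊆ O ∧ ∀ μ ∈ invariantProb Γ X, μ.real O ≤ c := by
  rcases C.eq_empty_or_nonempty with rfl | hne
  · exact ⟨∅, isOpen_empty, subset_rfl, fun μ hμ => (hc μ hμ).le⟩
  obtain ⟨F, hF⟩ := hΓ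
  obtain ⟨n, hn⟩ := (eventually_card_visits_le hF ({()} : Finset Unit) (C := fun _ => C)
    (fun _ _ => hC) (by simpa using hc)).exists
  have hn' : ∀ x : X, (((F n).filter fun γ => γ⁻¹ • x ∈ C).card : ℝ) ≤ c * (F n).card := by
    intro x
    refine le_trans (le_of_eq ?_) (hn x)
    rw [Finset.card_filter]
    push_cast
    refine Finset.sum_congr rfl fun γ _ => ?_
    by_cases h : γ⁻¹ • x ∈ C <;> simp [h]
  -- No point visits `C` at all times of so large a set `A`, so by compactness the total distance to
  -- `C` over `A` is bounded below. Hence a small neighbourhood of `C` is visited no more often than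
  -- the bound for `C`.
  have hδ : ∀ A ∈ (F n).powerset.filter (fun A => c * (F n).card < A.card),
      ∃ δ : ℝ, 0 < δ ∧ ∀ x : X, δ ≤ ∑ γ ∈ A, Metric.infDist (γ⁻¹ • x) C := by
    intro A hA
    obtain ⟨hAF, hAc⟩ := Finset.mem_filter.1 hA
    obtain ⟨δ, hδ, hle⟩ := (isCompact_univ (X := X)).exists_forall_le' (a := 0)
      (f := fun x => ∑ γ ∈ A, Metric.infDist (γ⁻¹ • x) C)
      (continuous_finsetSum _ fun γ _ =>
        (Metric.continuous_infDist_pt C).comp (continuous_const_smul _)).continuousOn (by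
      intro x _
      by_contra! hle
      have h0 : ∀ γ ∈ A, Metric.infDist (γ⁻¹ • x) C = 0 :=
        (Finset.sum_eq_zero_iff_of_nonneg fun _ _ => Metric.infDist_nonneg).1
          (le_antisymm hle (Finset.sum_nonneg fun _ _ => Metric.infDist_nonneg))
      have hsub : A ⊆ (F n).filter fun γ => γ⁻¹ • x ∈ C := fun γ hγ =>
        Finset.mem_filter.2 ⟨Finset.mem_powerset.1 hAF hγ,
          (hC.mem_iff_infDist_zero hne).2 (h0 γ hγ)⟩
      have h1 : (A.card : ℝ) ≤ ((F n).filter fun γ => γ⁻¹ • x ∈ C).card := by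
        exact_mod_cast Finset.card_le_card hsub
      linarith [hn' x])
    exact ⟨δ, hδ, fun x => hle x (Set.mem_univ x)⟩
  choose! δ hδpos hδ using hδ
  set 𝓐 := (F n).powerset.filter (fun A => c * (F n).card < A.card) with h𝓐
  obtain ⟨δ₀, hδ₀, hle⟩ : ∃ δ₀ : ℝ, 0 < δ₀ ∧ ∀ A ∈ 𝓐, δ₀ ≤ δ A := by
    rcases 𝓐.eq_empty_or_nonempty with h | h
    · exact ⟨1, one_pos, by simp [h]⟩
    · exact ⟨𝓐.inf' h δ, (Finset.lt_inf'_iff h).2 hδpos, fun E hE => Finset.inf'_le _ hE⟩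
  have hpos : (0 : ℝ) < (F n).card := by exact_mod_cast (hF.1 n).card_pos
  have hO : IsOpen {x : X | Metric.infDist x C < δ₀ / (F n).card} :=
    isOpen_lt (Metric.continuous_infDist_pt C) continuous_const
  refine ⟨_, hO, fun x hx => ?_, fun μ hμ => ?_⟩
  · rw [Set.mem_ofPred_eq, Metric.infDist_zero_of_mem hx]
    positivity
  · refine measureReal_le_of_card_visits_le hμ (hF.1 n) hO.measurableSet fun x => ?_
    by_contra! hlt
    set A := (F n).filter fun γ => γ⁻¹ • x ∈ {x : X | Metric.infDist x C < δ₀ / (F n).card}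
      with hA
    have hA𝓐 : A ∈ 𝓐 := by
      refine Finset.mem_filter.2 ⟨Finset.mem_powerset.2 (Finset.filter_subset _ _), ?_⟩
      convert hlt
    have h1 := (hle A hA𝓐).trans (hδ A hA𝓐 x)
    have hAne : A.Nonempty := by
      by_contra hempty
      rw [Finset.not_nonempty_iff_eq_empty] at hempty
      rw [hempty, Finset.sum_empty] at h1
      linarith
    have h2 : ∑ γ ∈ A, Metric.infDist (γ⁻¹ • x) C < ∑ γ ∈ A, δ₀ / (F n).card :=
      Finset.sum_lt_sum_of_nonempty hAne fun γ hγ => (Finset.mem_filter.1 hγ).2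
    have h3 : ∑ γ ∈ A, δ₀ / (F n).card ≤ δ₀ := by
      rw [Finset.sum_const, nsmul_eq_mul, mul_div_assoc', div_le_iff₀ hpos, mul_comm]
      gcongr
      exact Finset.filter_subset _ _
    linarith

end InvariantMeasures

/-! ### The dimension of joins as a subadditive function of finite sets. -/

section CoverOrder

open scoped Classical

variable {X : Type*} [TopologicalSpace X]

/-- `𝒰` has a finite open refinement of order at most `d`. -/
def HasOrderLE (𝒰 : Set (Set X)) (d : ℝ) : Prop :=
  ∃ 𝒱 : Finset (Set X), IsOpenCover 𝒱 ∧ Refines (𝒱 : Set (Set X)) 𝒰 ∧ ∀ x, ordAt 𝒱 x ≤ d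

/-- The dimension of a cover as a natural number. -/
noncomputable def coverOrder (𝒰 : Set (Set X)) : ℕ := sInf {n : ℕ | HasOrderLE 𝒰 n}

theorem HasOrderLE.mono {𝒰 : Set (Set X)} {d e : ℝ} (h : HasOrderLE 𝒰 d) (hde : d ≤ e) :
    HasOrderLE 𝒰 e := by
  obtain ⟨𝒱, h1, h2, h3⟩ := h
  exact ⟨𝒱, h1, h2, fun x => (h3 x).trans hde⟩

theorem HasOrderLE.coverOrder {𝒰 : Set (Set X)} {d : ℝ} (h : HasOrderLE 𝒰 d) :
    HasOrderLE 𝒰 (coverOrder 𝒰) :=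
  Nat.sInf_mem (s := {n : ℕ | HasOrderLE 𝒰 n}) ⟨⌈d⌉₊, h.mono (Nat.le_ceil d)⟩

/-- Orders are integers and, at an existing point, nonnegative, so `d` may be rounded down. -/
theorem HasOrderLE.coverOrder_le [Nonempty X] {𝒰 : Set (Set X)} {d : ℝ} (h : HasOrderLE 𝒰 d) :
    (DynDim.coverOrder 𝒰 : ℝ) ≤ d := by
  obtain ⟨𝒱, h1, h2, h3⟩ := h
  have hcard : ∀ x, 1 ≤ (𝒱.filter fun V => x ∈ V).card := fun x => by
    obtain ⟨V, hV, hx⟩ := h1.exists_mem x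
    exact Finset.card_pos.2 ⟨V, Finset.mem_filter.2 ⟨hV, hx⟩⟩
  have hd : 0 ≤ d := by
    obtain ⟨x⟩ := ‹Nonempty X›
    have := h3 x
    rw [ordAt_eq] at this
    have h4 : (1 : ℝ) ≤ (𝒱.filter fun V => x ∈ V).card := by exact_mod_cast hcard x
    linarith
  refine le_trans ?_ (Nat.floor_le hd)
  refine Nat.cast_le.2 (Nat.sInf_le ⟨𝒱, h1, h2, fun x => ?_⟩)
  have h4 := h3 x
  rw [ordAt_eq] at h4 ⊢
  have h5 : ((𝒱.filter fun V => x ∈ V).card - 1 : ℕ) ≤ ⌊d⌋₊ := by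
    refine Nat.le_floor ?_
    rw [Nat.cast_sub (hcard x)]
    simpa using h4
  have h6 : (𝒱.filter fun V => x ∈ V).card ≤ ⌊d⌋₊ + 1 := by omega
  have h7 : ((𝒱.filter fun V => x ∈ V).card : ℝ) ≤ ⌊d⌋₊ + 1 := by exact_mod_cast h6
  linarith

theorem HasOrderLE.coverDim_eq [Nonempty X] {𝒰 : Set (Set X)} {d : ℝ} (h : HasOrderLE 𝒰 d) :
    coverDim 𝒰 = ((DynDim.coverOrder 𝒰 : ℝ) : EReal) := by
  refine le_antisymm ?_ (le_iInf₂ fun 𝒱 h𝒱 => ?_)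
  · obtain ⟨𝒱, h1, h2, h3⟩ := h.coverOrder
    exact iInf₂_le_of_le 𝒱 ⟨h1, h2⟩ (iSup_le fun x => EReal.coe_le_coe_iff.2 (h3 x))
  · by_contra! hlt
    have h1 : HasOrderLE 𝒰 ((DynDim.coverOrder 𝒰 : ℝ) - 1) := by
      refine ⟨𝒱, h𝒱.1, h𝒱.2, fun x => ?_⟩
      have h2 : (ordAt 𝒱 x : EReal) < ((DynDim.coverOrder 𝒰 : ℝ) : EReal) :=
        (le_iSup (fun x => (ordAt 𝒱 x : EReal)) x).trans_lt hlt
      rw [EReal.coe_lt_coe_iff, ordAt_eq] at h2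
      rw [ordAt_eq]
      have h3 : ((𝒱.filter fun V => x ∈ V).card : ℝ) < DynDim.coverOrder 𝒰 + 1 := by linarith
      have h4 : (𝒱.filter fun V => x ∈ V).card < DynDim.coverOrder 𝒰 + 1 := by exact_mod_cast h3
      have h5 : ((𝒱.filter fun V => x ∈ V).card : ℝ) ≤ DynDim.coverOrder 𝒰 := by
        exact_mod_cast Nat.lt_succ_iff.1 h4
      linarith
    linarith [h1.coverOrder_le]

variable {Γ : Type*} [Group Γ] [MulAction Γ X]

theorem hasOrderLE_iteratedJoin_empty (𝒰 : Finset (Set X)) :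
    HasOrderLE (iteratedJoin (∅ : Finset Γ) 𝒰) 0 := by
  refine ⟨{Set.univ}, ⟨by simp, by simp⟩, fun V _ => ⟨Set.univ, ⟨fun _ => ∅, by simp, by simp⟩,
    Set.subset_univ V⟩, fun x => ?_⟩
  rw [ordAt_eq]
  simp [Finset.filter_singleton]

theorem HasOrderLE.smul [ContinuousConstSMul Γ X] {𝒰 : Finset (Set X)} {F : Finset Γ} {d : ℝ}
    (h : HasOrderLE (iteratedJoin F 𝒰) d) (c : Γ) : HasOrderLE (iteratedJoin (c • F) 𝒰) d := by
  obtain ⟨𝒱, ⟨ho, hcov⟩, href, hord⟩ := h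
  refine ⟨𝒱.image fun V => c • V, ⟨?_, ?_⟩, ?_, fun x => ?_⟩
  · intro V hV
    obtain ⟨W, hW, rfl⟩ := Finset.mem_image.1 hV
    exact (ho W hW).smul c
  · rw [Set.eq_univ_iff_forall]
    intro x
    obtain ⟨V, hV, hx⟩ := IsOpenCover.exists_mem ⟨ho, hcov⟩ (c⁻¹ • x)
    exact Set.mem_biUnion (Finset.mem_image_of_mem _ hV) (Set.mem_smul_set_iff_inv_smul_mem.2 hx)
  · intro V hV
    obtain ⟨W, hW, rfl⟩ := Finset.mem_image.1 (Finset.mem_coe.1 hV)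
    obtain ⟨_, ⟨u, hu, rfl⟩, hsub⟩ := href W hW
    refine ⟨_, ⟨fun γ => u (c⁻¹ * γ), fun γ hγ => hu _ (Finset.inv_smul_mem_iff.2 hγ), rfl⟩, ?_⟩
    refine Set.subset_iInter₂ fun γ hγ => ?_
    rw [Set.smul_set_subset_iff_subset_inv_smul_set, smul_smul]
    exact hsub.trans (Set.biInter_subset_of_mem (Finset.inv_smul_mem_iff.2 hγ))
  · refine (ordAt_image_le _ _ _).trans (le_trans (le_of_eq ?_) (hord (c⁻¹ • x)))
    rw [ordAt_eq]
    simp only [Set.mem_smul_set_iff_inv_smul_mem]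

theorem coverOrder_iteratedJoin_smul [ContinuousConstSMul Γ X] (𝒰 : Finset (Set X))
    (F : Finset Γ) (c : Γ) :
    coverOrder (iteratedJoin (c • F) 𝒰) = coverOrder (iteratedJoin F 𝒰) := by
  have : ∀ n : ℕ, HasOrderLE (iteratedJoin (c • F) 𝒰) n ↔ HasOrderLE (iteratedJoin F 𝒰) n :=
    fun n => ⟨fun h => by simpa using h.smul c⁻¹, fun h => h.smul c⟩
  simp only [coverOrder, this]

/-- `exists_joint_cover` for two covers; it provides the subadditivity needed in `ornstein_weiss`.
-/
theorem HasOrderLE.union [NormalSpace X] {𝒰 : Finset (Set X)} {A B : Finset Γ} {a b : ℝ}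
    (hA : HasOrderLE (iteratedJoin A 𝒰) a) (hB : HasOrderLE (iteratedJoin B 𝒰) b) :
    HasOrderLE (iteratedJoin (A ∪ B) 𝒰) (a + b) := by
  obtain ⟨𝒱, h𝒱, href, hord⟩ := hA
  obtain ⟨𝒱', h𝒱', href', hord'⟩ := hB
  obtain ⟨ρ, hρc, hρs, hρp⟩ := h𝒱.exists_partition
  obtain ⟨ρ', hρc', hρs', hρp'⟩ := h𝒱'.exists_partition
  obtain ⟨𝒲, h𝒲, hsub, hle⟩ := exists_joint_cover (Finset.univ : Finset Bool)
    (fun i => if i then 𝒱 else 𝒱') (fun i => if i then ρ else ρ')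
    (fun i k => by cases i <;> simp [hρc, hρc'])
    (fun i _ x => by cases i <;> simp [hρp, hρp'])
  refine ⟨𝒲, h𝒲, fun W hW => ?_, fun x => (hle x).trans ?_⟩
  · obtain ⟨V, hV, hWV⟩ := hsub W hW true (Finset.mem_univ _)
    obtain ⟨V', hV', hWV'⟩ := hsub W hW false (Finset.mem_univ _)
    simp only [if_true, Bool.false_eq_true, if_false] at hV hWV hV' hWV'
    obtain ⟨_, ⟨u, hu, rfl⟩, hVu⟩ := href V hV
    obtain ⟨_, ⟨u', hu', rfl⟩, hVu'⟩ := href' V' hV'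
    refine ⟨_, ⟨fun γ => if γ ∈ A then u γ else u' γ, fun γ hγ => ?_, rfl⟩, fun x hx => ?_⟩
    · by_cases h : γ ∈ A
      · simpa [h] using hu γ h
      · simpa [h] using hu' γ ((Finset.mem_union.1 hγ).resolve_left h)
    · have h1 := hVu (hρs V hV (subset_closure (hWV x hx)))
      have h2 := hVu' (hρs' V' hV' (subset_closure (hWV' x hx)))
      simp only [Set.mem_iInter] at h1 h2 ⊢
      intro γ hγ
      by_cases h : γ ∈ A
      · simpa [h] using h1 γ h
      · simpa [h] using h2 γ ((Finset.mem_union.1 hγ).resolve_left h)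
  · rw [Fintype.sum_bool]
    have h1 : ∀ {𝒱 : Finset (Set X)} {ρ : Set X → X → NNReal},
        (∀ w ∈ 𝒱, closure {x | 0 < ρ w x} ⊆ w) →
        ((𝒱.filter fun k => 0 < ρ k x).card : ℝ) - 1 ≤ ordAt 𝒱 x := by
      intro 𝒱 ρ hs
      rw [ordAt_eq]
      gcongr with V hV
      intro hx
      exact hs V hV (subset_closure hx)
    exact add_le_add ((h1 hρs).trans (hord x)) ((h1 hρs').trans (hord' x))

/-- A crude bound that makes `coverOrder` meaningful and supplies the constant `C` of
`ornstein_weiss`. -/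
theorem hasOrderLE_iteratedJoin [NormalSpace X] [ContinuousConstSMul Γ X] {𝒰 : Finset (Set X)}
    (h𝒰 : IsOpenCover 𝒰) (F : Finset Γ) : HasOrderLE (iteratedJoin F 𝒰) (𝒰.card * F.card) := by
  have h1 : HasOrderLE (iteratedJoin ({1} : Finset Γ) 𝒰) 𝒰.card := by
    refine ⟨𝒰, h𝒰, fun U hU => ⟨U, ⟨fun _ => U, fun _ _ => hU, by simp⟩, subset_rfl⟩, fun x => ?_⟩
    rw [ordAt_eq]
    have : ((𝒰.filter fun U => x ∈ U).card : ℝ) ≤ 𝒰.card := by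
      exact_mod_cast Finset.card_filter_le _ _
    linarith
  induction F using Finset.induction_on with
  | empty => exact (hasOrderLE_iteratedJoin_empty 𝒰).mono (by simp)
  | insert a s ha ih =>
    have h2 := (h1.smul a).union ih
    rw [Finset.smul_finset_singleton, smul_eq_mul, mul_one] at h2
    rw [Finset.card_insert_of_notMem ha, Finset.insert_eq]
    refine h2.mono (le_of_eq ?_)
    push_cast
    ring

theorem coverOrder_iteratedJoin_union_le [NormalSpace X] [Nonempty X] [ContinuousConstSMul Γ X]
    {𝒰 : Finset (Set X)} (h𝒰 : IsOpenCover 𝒰) (A B : Finset Γ) :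
    (coverOrder (iteratedJoin (A ∪ B) 𝒰) : ℝ) ≤
      coverOrder (iteratedJoin A 𝒰) + coverOrder (iteratedJoin B 𝒰) :=
  ((hasOrderLE_iteratedJoin h𝒰 A).coverOrder.union
    (hasOrderLE_iteratedJoin h𝒰 B).coverOrder).coverOrder_le

end CoverOrder

/-! ### Comparison of the normalized dimensions with the integrated orders. -/

section Comparison

open scoped Classical

theorem integral_ordAt {X : Type*} [MeasurableSpace X] {μ : Measure X} [IsProbabilityMeasure μ]
    {𝒱 : Finset (Set X)} (h : ∀ V ∈ 𝒱, MeasurableSet V) :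
    ∫ x, ordAt 𝒱 x ∂μ = -1 + ∑ V ∈ 𝒱, μ.real V := by
  have hint : ∀ V ∈ 𝒱, Integrable (V.indicator fun _ => (1 : ℝ)) μ := fun V hV =>
    (integrable_const _).indicator (h V hV)
  unfold ordAt
  rw [integral_add (integrable_const _) (integrable_finsetSum _ hint), integral_finsetSum _ hint]
  simp only [integral_const, probReal_univ, one_smul]
  congr 1
  exact Finset.sum_congr rfl fun V hV => by simp [integral_indicator_const _ (h V hV)]

/-- Sets which overlap at most `m` times inside `B` have total mass at most `m` times that
of `B`. -/
theorem sum_measureReal_inter_le {X κ : Type*} [MeasurableSpace X] {μ : Measure X}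
    [IsProbabilityMeasure μ] {B : Set X} (hB : MeasurableSet B) (I : Finset κ) {A : κ → Set X}
    (hA : ∀ k ∈ I, MeasurableSet (A k)) {m : ℝ}
    (h : ∀ x, ((I.filter fun k => x ∈ A k).card : ℝ) ≤ m) :
    ∑ k ∈ I, μ.real (B ∩ A k) ≤ m * μ.real B := by
  have hint : ∀ k ∈ I, Integrable ((B ∩ A k).indicator fun _ => (1 : ℝ)) μ := fun k hk =>
    (integrable_const _).indicator (hB.inter (hA k hk))
  have h1 : ∑ k ∈ I, μ.real (B ∩ A k) =
      ∫ x, ∑ k ∈ I, (B ∩ A k).indicator (fun _ => (1 : ℝ)) x ∂μ := by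
    rw [integral_finsetSum _ hint]
    exact Finset.sum_congr rfl fun k hk => by
      simp [integral_indicator_const _ (hB.inter (hA k hk))]
  have h2 : m * μ.real B = ∫ x, B.indicator (fun _ => m) x ∂μ := by
    rw [integral_indicator_const _ hB, smul_eq_mul, mul_comm]
  rw [h1, h2]
  refine integral_mono (integrable_finsetSum _ hint) ((integrable_const _).indicator hB)
    fun x => ?_
  by_cases hx : x ∈ B
  · refine le_trans (le_of_eq ?_) ((h x).trans_eq
      (Set.indicator_of_mem hx fun _ => m).symm)
    rw [Finset.card_filter]
    push_cast
    exact Finset.sum_congr rfl fun k _ => by simp [Set.indicator_apply, hx]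
  · simp [hx]

/-- Inversion exchanges the two sides: tower shapes are invariant on the left, while the bounds for
joins concern sets invariant on the right. -/
theorem rightInvariant_inv {Γ : Type*} [Group Γ] {K S : Finset Γ} {ε : ℝ}
    (h : IsInvariantSet K⁻¹ ε S) : RightInvariant K ε S⁻¹ := by
  intro g hg
  rw [Finset.card_inv]
  refine le_trans (Nat.cast_le.2 ?_) (h.2 g⁻¹ (Finset.inv_mem_inv hg)).le
  unfold escape
  rw [← Finset.card_inv]
  refine le_trans (Finset.card_le_card fun s hs => ?_)
    (Finset.card_image_le (f := fun s => g * s))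
  rw [Finset.mem_inv'] at hs
  obtain ⟨h1, h2⟩ := Finset.mem_filter.1 hs
  refine Finset.mem_image.2 ⟨g⁻¹ * s, ?_, by simp⟩
  rw [Finset.mem_symmDiff]
  refine Or.inl ⟨Finset.mem_image_of_mem _ (by simpa using h1), fun h3 => h2 ?_⟩
  simpa using h3

theorem rightInvariant_of_isFolnerSeq {Γ : Type*} [Group Γ] {F : ℕ → Finset Γ}
    (hF : IsFolnerSeq F) (K : Finset Γ) {δ : ℝ} (hδ : 0 < δ) :
    ∀ᶠ n in atTop, RightInvariant K δ (F n) := by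
  have h1 : ∀ g ∈ K, ∀ᶠ n in atTop, (escape g (F n) : ℝ) ≤ δ * (F n).card := by
    intro g _
    filter_upwards [(hF.2 g).eventually_lt_const hδ] with n hn
    have hpos : (0 : ℝ) < (F n).card := by exact_mod_cast (hF.1 n).card_pos
    rw [div_lt_iff₀ hpos] at hn
    refine le_trans (Nat.cast_le.2 ?_) hn.le
    unfold escape
    refine le_trans (Finset.card_le_card fun d hd => ?_)
      (Finset.card_image_le (f := fun s => s * g⁻¹))
    obtain ⟨h1, h2⟩ := Finset.mem_filter.1 hd
    refine Finset.mem_image.2 ⟨d * g, ?_, by simp⟩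
    rw [Finset.mem_symmDiff]
    exact Or.inl ⟨Finset.mem_image_of_mem _ h1, h2⟩
  exact (Finset.eventually_all K).2 h1

variable {Γ : Type*} [Group Γ] {X : Type*} [MetricSpace X] [CompactSpace X]
  [MeasurableSpace X] [BorelSpace X] [MulAction Γ X] [ContinuousConstSMul Γ X]

/-- A refinement of small integrated order bounds the dimension of the joint refinements. -/
theorem eventually_hasOrderLE {F : ℕ → Finset Γ} (hF : IsFolnerSeq F) {𝒰 𝒱 : Finset (Set X)}
    (h𝒱 : IsOpenCover 𝒱) (href : Refines (𝒱 : Set (Set X)) 𝒰) {c : ℝ}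
    (hc : ∀ μ ∈ invariantProb Γ X, ∫ x, ordAt 𝒱 x ∂μ < c) :
    ∀ᶠ n in atTop, HasOrderLE (iteratedJoin (F n) 𝒰) (c * (F n).card) := by
  obtain ⟨ρ, hρc, hρs, hρp⟩ := h𝒱.exists_partition
  -- Visits count memberships rather than orders, hence `c + 1`; the extra `1` per group element is
  -- cancelled by the `-1` in `exists_joint_cover`.
  have hev := eventually_card_visits_le hF 𝒱 (C := fun V => closure {x | 0 < ρ V x})
    (fun _ _ => isClosed_closure) (c := c + 1) fun μ hμ => by
      have := hμ.1
      have h1 := hc μ hμ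
      rw [integral_ordAt fun V hV => (h𝒱.1 V hV).measurableSet] at h1
      have h2 : ∑ V ∈ 𝒱, μ.real (closure {x | 0 < ρ V x}) ≤ ∑ V ∈ 𝒱, μ.real V :=
        Finset.sum_le_sum fun V hV => measureReal_mono (hρs V hV)
      linarith
  filter_upwards [hev] with n hn
  obtain ⟨𝒲, h𝒲, hsub, hle⟩ := exists_joint_cover (F n) (fun _ => 𝒱)
    (fun γ V x => ρ V (γ⁻¹ • x)) (fun γ V => (hρc V).comp (continuous_const_smul _))
    (fun γ _ x => hρp _)
  refine ⟨𝒲, h𝒲, fun W hW => ?_, fun x => (hle x).trans ?_⟩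
  · choose! V hV hWV using hsub W hW
    choose! u hu hVu using fun V hV => href V hV
    refine ⟨_, ⟨fun γ => u (V γ), fun γ hγ => hu _ (hV γ hγ), rfl⟩, fun x hx => ?_⟩
    refine Set.mem_iInter₂.2 fun γ hγ => ?_
    rw [Set.mem_smul_set_iff_inv_smul_mem]
    exact hVu _ (hV γ hγ) (hρs _ (hV γ hγ) (subset_closure (hWV γ hγ x hx)))
  · rw [Finset.sum_sub_distrib]
    simp only [Finset.sum_const, nsmul_eq_mul, mul_one]
    have h1 : ∑ γ ∈ F n, ((𝒱.filter fun V => 0 < ρ V (γ⁻¹ • x)).card : ℝ) ≤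
        ∑ γ ∈ F n, ((𝒱.filter fun V => γ⁻¹ • x ∈ closure {x | 0 < ρ V x}).card : ℝ) := by
      refine Finset.sum_le_sum fun γ _ => Nat.cast_le.2 (Finset.card_le_card fun V hV => ?_)
      obtain ⟨h1, h2⟩ := Finset.mem_filter.1 hV
      exact Finset.mem_filter.2 ⟨h1, subset_closure h2⟩
    linarith [hn x]

-- The levels are disjoint, and those of the same tower have equal measure.
omit [CompactSpace X] in
theorem sum_card_mul_measureReal_le_one {μ : Measure X} (hμ : μ ∈ invariantProb Γ X) {r : ℕ}
    {V : Fin r → Set X} {S : Fin r → Finset Γ} (hV : ∀ i, IsOpen (V i))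
    (hdisj : ∀ i, ∀ γ ∈ S i, ∀ j, ∀ δ ∈ S j, (i, γ) ≠ (j, δ) → Disjoint (γ • V i) (δ • V j)) :
    ∑ i, (S i).card * μ.real (V i) ≤ 1 := by
  have := hμ.1
  have := hμ.2
  have h1 := measureReal_biUnion_finset (μ := μ) (s := Finset.univ.sigma S)
    (f := fun a : Σ _ : Fin r, Γ => a.2 • V a.1) (fun a ha b hb hab => by
      refine hdisj _ _ (Finset.mem_sigma.1 ha).2 _ _ (Finset.mem_sigma.1 hb).2 fun h => hab ?_
      obtain ⟨h1, h2⟩ := Prod.ext_iff.1 h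
      exact Sigma.ext h1 (heq_of_eq h2)) (fun a _ => ((hV a.1).smul a.2).measurableSet)
  rw [Finset.sum_sigma] at h1
  have h2 : ∀ i, ∑ γ ∈ S i, μ.real (γ • V i) = (S i).card * μ.real (V i) := by
    intro i
    rw [← nsmul_eq_mul]
    exact Finset.sum_eq_card_nsmul fun γ _ => by
      rw [measureReal_def, measure_smul, measureReal_def]
  simp only [h2] at h1
  rw [← h1]
  exact measureReal_le_one

/-- Under the uniform Rokhlin property, a bound for the dimensions of the joint refinements along
sufficiently invariant sets gives refinements of small integrated order. -/
theorem HasURP.exists_refinement (hX : HasURP Γ X) (hΓ : IsAmenable Γ) {𝒰 : Finset (Set X)}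
    (h𝒰 : IsOpenCover 𝒰) {K : Finset Γ} {δ a η : ℝ} (hδ : 0 < δ) (hη : 0 < η) (ha : 0 ≤ a)
    (h : ∀ D : Finset Γ, RightInvariant K δ D →
      (coverOrder (iteratedJoin D 𝒰) : ℝ) ≤ a * D.card) :
    ∃ 𝒱 : Finset (Set X), IsOpenCover 𝒱 ∧ Refines (𝒱 : Set (Set X)) (𝒰 : Set (Set X)) ∧
      ∀ μ ∈ invariantProb Γ X, ∫ x, ordAt 𝒱 x ∂μ ≤ a + η := by
  -- The first bound makes the shapes invariant enough for `h`; the second limits the contribution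
  -- of the remainder to `η`.
  set ε : ℝ := min δ (η / (𝒰.card + 1)) with hε
  have hε0 : 0 < ε := by positivity
  have hεη : 𝒰.card * ε ≤ η := by
    have h1 : ε ≤ η / (𝒰.card + 1) := min_le_right _ _
    rw [le_div_iff₀ (by positivity)] at h1
    linarith
  obtain ⟨r, V, S, hVo, hSinv, hdisj, hcap⟩ := hX K⁻¹ ε hε0
  have hEo : IsOpen (⋃ i, ⋃ γ ∈ S i, γ • V i) :=
    isOpen_iUnion fun i => isOpen_biUnion fun γ _ => (hVo i).smul γ
  obtain ⟨O, hO, hCO, hμO⟩ := exists_isOpen_capacity_le hΓ hEo.isClosed_compl (c := ε)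
    fun μ hμ => by
      have := hμ.1
      refine (ENNReal.lt_ofReal_iff_toReal_lt (measure_ne_top μ _)).1 (lt_of_le_of_lt ?_ hcap)
      exact le_iSup₂_of_le μ hμ le_rfl
  have hord : ∀ i, ∃ 𝒲 : Finset (Set X), IsOpenCover 𝒲 ∧
      Refines (𝒲 : Set (Set X)) (iteratedJoin (S i)⁻¹ 𝒰) ∧
      ∀ x, ordAt 𝒲 x ≤ a * (S i).card := by
    intro i
    obtain ⟨𝒲, h1, h2, h3⟩ := (hasOrderLE_iteratedJoin h𝒰 (S i)⁻¹).coverOrder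
    refine ⟨𝒲, h1, h2, fun x => (h3 x).trans ?_⟩
    have := h _ ((rightInvariant_inv (hSinv i)).mono subset_rfl (min_le_left _ _))
    rwa [Finset.card_inv] at this
  choose 𝒲 h𝒲 href hle using hord
  -- One share of `𝒲 i` for each level. Since `𝒲 i` refines the join over `(S i)⁻¹`, the translate
  -- of any share by `γ ∈ S i` still refines `𝒰`.
  choose W hW hWcov hWle using fun i => (h𝒲 i).exists_split (S i)
  set I : Finset (Σ _ : Fin r, Γ × Set X) := Finset.univ.sigma fun i => S i ×ˢ 𝒲 i with hI
  set A : (Σ _ : Fin r, Γ × Set X) → Set X := fun k =>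
    k.2.1 • (V k.1 ∩ W k.1 k.2.1 k.2.2) with hA
  have hIm : ∀ k ∈ I, k.2.1 ∈ S k.1 ∧ k.2.2 ∈ 𝒲 k.1 := fun k hk =>
    Finset.mem_product.1 (Finset.mem_sigma.1 hk).2
  have hVW : ∀ k ∈ I, IsOpen (V k.1 ∩ W k.1 k.2.1 k.2.2) := fun k hk =>
    (hVo _).inter (hW _ _ _ (hIm k hk).2).1
  have hopen : ∀ U ∈ I.image A ∪ 𝒰.image (fun U => U ∩ O), IsOpen U := by
    intro U hU
    rcases Finset.mem_union.1 hU with hU | hU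
    · obtain ⟨k, hk, rfl⟩ := Finset.mem_image.1 hU
      exact (hVW k hk).smul _
    · obtain ⟨U, hU', rfl⟩ := Finset.mem_image.1 hU
      exact (h𝒰.1 U hU').inter hO
  refine ⟨I.image A ∪ 𝒰.image fun U => U ∩ O, ⟨hopen, ?_⟩, ?_, fun μ hμ => ?_⟩
  · rw [Set.eq_univ_iff_forall]
    intro x
    by_cases hx : x ∈ ⋃ i, ⋃ γ ∈ S i, γ • V i
    · obtain ⟨i, hx⟩ := Set.mem_iUnion.1 hx
      obtain ⟨γ, hγ, hx⟩ := Set.mem_iUnion₂.1 hx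
      rw [Set.mem_smul_set_iff_inv_smul_mem] at hx
      obtain ⟨w, hw, hxw⟩ := hWcov i γ (γ⁻¹ • x)
      refine Set.mem_biUnion (Finset.mem_union_left _ (Finset.mem_image_of_mem A
        (a := ⟨i, γ, w⟩) ?_)) ?_
      · exact Finset.mem_sigma.2 ⟨Finset.mem_univ _, Finset.mem_product.2 ⟨hγ, hw⟩⟩
      · exact Set.mem_smul_set_iff_inv_smul_mem.2 ⟨hx, hxw⟩
    · obtain ⟨U, hU, hxU⟩ := h𝒰.exists_mem x
      exact Set.mem_biUnion (Finset.mem_union_right _ (Finset.mem_image_of_mem _ hU))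
        ⟨hxU, hCO hx⟩
  · intro U hU
    rcases Finset.mem_union.1 (Finset.mem_coe.1 hU) with hU | hU
    · obtain ⟨k, hk, rfl⟩ := Finset.mem_image.1 hU
      obtain ⟨hkS, hk𝒲⟩ := hIm k hk
      obtain ⟨_, ⟨u, hu, rfl⟩, hsub⟩ := href k.1 k.2.2 hk𝒲
      have hinv : k.2.1⁻¹ ∈ (S k.1)⁻¹ := Finset.inv_mem_inv hkS
      refine ⟨u k.2.1⁻¹, hu _ hinv, ?_⟩
      simp only [hA]
      rw [Set.smul_set_subset_iff_subset_inv_smul_set]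
      exact Set.inter_subset_right.trans ((hW _ _ _ hk𝒲).2.trans
        (hsub.trans (Set.biInter_subset_of_mem hinv)))
    · obtain ⟨U, hU', rfl⟩ := Finset.mem_image.1 hU
      exact ⟨U, hU', Set.inter_subset_left⟩
  · have := hμ.1
    have := hμ.2
    rw [integral_ordAt fun V hV => (hopen V hV).measurableSet]
    have h1 : ∑ V ∈ I.image A ∪ 𝒰.image (fun U => U ∩ O), μ.real V ≤
        ∑ k ∈ I, μ.real (A k) + ∑ U ∈ 𝒰, μ.real (U ∩ O) := by
      have hnn : ∀ s : Set X, 0 ≤ μ.real s := fun _ => measureReal_nonneg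
      have h2 : ∑ V ∈ I.image A, μ.real V ≤ ∑ k ∈ I, μ.real (A k) :=
        Finset.sum_image_le_of_nonneg fun _ _ => hnn _
      have h2' : ∑ V ∈ 𝒰.image (fun U => U ∩ O), μ.real V ≤ ∑ U ∈ 𝒰, μ.real (U ∩ O) :=
        Finset.sum_image_le_of_nonneg fun _ _ => hnn _
      have h3 := Finset.sum_union_inter (s₁ := I.image A) (s₂ := 𝒰.image fun U => U ∩ O)
        (f := fun V => μ.real V)
      have h4 : 0 ≤ ∑ V ∈ I.image A ∩ 𝒰.image (fun U => U ∩ O), μ.real V :=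
        Finset.sum_nonneg fun _ _ => hnn _
      linarith
    have h2 : ∑ U ∈ 𝒰, μ.real (U ∩ O) ≤ 𝒰.card * ε := by
      rw [← nsmul_eq_mul]
      exact Finset.sum_le_card_nsmul _ _ _ fun U _ =>
        (measureReal_mono Set.inter_subset_right).trans (hμO μ hμ)
    -- By invariance all levels are measured on the base, where the shares together overlap at most
    -- `a |S i| + |S i|` times.
    have h3 : ∀ i, ∑ k ∈ S i ×ˢ 𝒲 i, μ.real (A ⟨i, k⟩) ≤
        (a + 1) * ((S i).card * μ.real (V i)) := by
      intro i
      have h4 : ∀ k : Γ × Set X, μ.real (A ⟨i, k⟩) = μ.real (V i ∩ W i k.1 k.2) := fun k => by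
        simp only [hA, measureReal_def, measure_smul]
      simp only [h4]
      refine (sum_measureReal_inter_le (hVo i).measurableSet _ (fun k hk =>
        (hW i k.1 k.2 (Finset.mem_product.1 hk).2).1.measurableSet)
        (m := (a + 1) * (S i).card) fun x => ?_).trans_eq (by ring)
      have h5 := (hWle i x).trans (hle i x)
      rw [Finset.sum_sub_distrib] at h5
      simp only [Finset.sum_const, nsmul_eq_mul, mul_one] at h5
      have h6 : (((S i ×ˢ 𝒲 i).filter fun k => x ∈ W i k.1 k.2).card : ℝ) =
          ∑ γ ∈ S i, (((𝒲 i).filter fun w => x ∈ W i γ w).card : ℝ) := by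
        rw [Finset.card_filter, Finset.sum_product]
        push_cast
        refine Finset.sum_congr rfl fun γ _ => ?_
        rw [Finset.card_filter]
        push_cast
        rfl
      rw [h6]
      linarith
    have h4 : ∑ k ∈ I, μ.real (A k) ≤ a + 1 := by
      rw [hI, Finset.sum_sigma]
      calc _ ≤ ∑ i, (a + 1) * ((S i).card * μ.real (V i)) := Finset.sum_le_sum fun i _ => h3 i
        _ = (a + 1) * ∑ i, (S i).card * μ.real (V i) := by rw [Finset.mul_sum]
        _ ≤ (a + 1) * 1 := mul_le_mul_of_nonneg_left
          (sum_card_mul_measureReal_le_one hμ hVo hdisj) (by linarith)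
        _ = a + 1 := mul_one _
    linarith

/-- Under the uniform Rokhlin property, the normalized dimensions of the joint refinements of a
cover converge to the infimum of the integrated orders of its refinements. -/
theorem HasURP.tendsto_coverDim (hX : HasURP Γ X) {F : ℕ → Finset Γ} (hF : IsFolnerSeq F)
    {𝒰 : Finset (Set X)} (h𝒰 : IsOpenCover 𝒰) :
    Tendsto (fun n => coverDim (iteratedJoin (F n) 𝒰) / ((F n).card : EReal)) atTop
      (𝓝 (⨅ (𝒱 : Finset (Set X))
        (_ : IsOpenCover 𝒱 ∧ Refines (𝒱 : Set (Set X)) (𝒰 : Set (Set X))),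
        ⨆ μ ∈ invariantProb Γ X, ((∫ x, ordAt 𝒱 x ∂μ : ℝ) : EReal))) := by
  rcases isEmpty_or_nonempty X with hempty | hne
  · have hcov : IsOpenCover (∅ : Finset (Set X)) :=
      ⟨by simp, Set.eq_univ_of_forall fun x => hempty.elim x⟩
    have h1 : ∀ n, coverDim (iteratedJoin (F n) 𝒰) = ⊥ := fun n =>
      le_bot_iff.1 (iInf₂_le_of_le ∅ ⟨hcov, by simp [Refines]⟩ (by simp [ord]))
    have h2 : (⨅ (𝒱 : Finset (Set X))
        (_ : IsOpenCover 𝒱 ∧ Refines (𝒱 : Set (Set X)) (𝒰 : Set (Set X))),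
        ⨆ μ ∈ invariantProb Γ X, ((∫ x, ordAt 𝒱 x ∂μ : ℝ) : EReal)) = ⊥ := by
      refine le_bot_iff.1 (iInf₂_le_of_le ∅ ⟨hcov, by simp [Refines]⟩ (iSup₂_le fun μ hμ => ?_))
      have := hμ.1
      exact absurd (nonempty_of_isProbabilityMeasure μ) (not_nonempty_iff.2 hempty)
    rw [h2]
    refine tendsto_const_nhds.congr fun n => ?_
    rw [h1, EReal.bot_div_of_pos_ne_top]
    · exact_mod_cast (hF.1 n).card_pos
    · exact EReal.natCast_ne_top _
  set D : EReal := ⨅ (𝒱 : Finset (Set X))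
        (_ : IsOpenCover 𝒱 ∧ Refines (𝒱 : Set (Set X)) (𝒰 : Set (Set X))),
        ⨆ μ ∈ invariantProb Γ X, ((∫ x, ordAt 𝒱 x ∂μ : ℝ) : EReal) with hD
  set h : Finset Γ → ℝ := fun A => (coverOrder (iteratedJoin A 𝒰) : ℝ) with hh
  have hpos : ∀ n, (0 : ℝ) < (F n).card := fun n => by exact_mod_cast (hF.1 n).card_pos
  have heq : ∀ n, coverDim (iteratedJoin (F n) 𝒰) / ((F n).card : EReal) =
      ((h (F n) / (F n).card : ℝ) : EReal) := by
    intro n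
    rw [(hasOrderLE_iteratedJoin h𝒰 (F n)).coverDim_eq, EReal.coe_div]
    rfl
  simp only [heq]
  have hupper : ∀ c : ℝ, D < c → ∀ᶠ n in atTop, h (F n) ≤ c * (F n).card := by
    intro c hc
    simp only [hD, iInf_lt_iff] at hc
    obtain ⟨𝒱, ⟨h𝒱, href⟩, hlt⟩ := hc
    filter_upwards [eventually_hasOrderLE hF h𝒱 href (c := c) fun μ hμ =>
      EReal.coe_lt_coe_iff.1 ((le_iSup₂_of_le μ hμ le_rfl).trans_lt hlt)] with n hn
    exact hn.coverOrder_le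
  -- A bound along a subsequence suffices, and this forces the limit to exist. Half of `z - c` is
  -- spent on `ornstein_weiss`, half on the remainder of the towers.
  have hlower : ∀ c : ℝ, 0 ≤ c → (∃ᶠ n in atTop, h (F n) ≤ c * (F n).card) → D ≤ c := by
    intro c hc hfreq
    refine EReal.le_of_forall_lt_iff_le.1 fun z hz => ?_
    have hz' : c < z := EReal.coe_lt_coe_iff.1 hz
    obtain ⟨K, δ, hδ, hK⟩ := ornstein_weiss (h := h) (C := 𝒰.card) (a := c) (by positivity) hc
      (fun A => (hasOrderLE_iteratedJoin h𝒰 A).coverOrder_le)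
      (fun g A => by simp only [hh, coverOrder_iteratedJoin_smul])
      (fun A B => coverOrder_iteratedJoin_union_le h𝒰 A B)
      (fun K δ hδ => by
        obtain ⟨n, hn, hinv⟩ :=
          (hfreq.and_eventually (rightInvariant_of_isFolnerSeq hF K hδ)).exists
        exact ⟨F n, hF.1 n, hinv, hn⟩) (half_pos (sub_pos.2 hz'))
    obtain ⟨𝒱, h𝒱, href, hle⟩ := hX.exists_refinement ⟨F, hF⟩ h𝒰 hδ (half_pos (sub_pos.2 hz'))
      (by linarith) hK
    refine iInf₂_le_of_le 𝒱 ⟨h𝒱, href⟩ (iSup₂_le fun μ hμ => EReal.coe_le_coe_iff.2 ?_)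
    linarith [hle μ hμ]
  rw [tendsto_order]
  refine ⟨fun b hb => ?_, fun b hb => ?_⟩
  · obtain ⟨c, hbc, hcD⟩ := EReal.lt_iff_exists_real_btwn.1 hb
    -- Below zero there is nothing to prove, as the values `h (F n)` are nonnegative; `hlower`
    -- covers the rest.
    rcases lt_or_ge c 0 with hc | hc
    · refine Eventually.of_forall fun n => hbc.trans (EReal.coe_lt_coe_iff.2 ?_)
      exact hc.trans_le (by positivity)
    · have h1 : ¬ ∃ᶠ n in atTop, h (F n) ≤ c * (F n).card := fun hfreq =>
        absurd (hlower c hc hfreq) (not_le.2 hcD)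
      rw [not_frequently] at h1
      filter_upwards [h1] with n hn
      refine hbc.trans (EReal.coe_lt_coe_iff.2 ?_)
      rw [lt_div_iff₀ (hpos n)]
      exact not_le.1 hn
  · obtain ⟨c, hDc, hcb⟩ := EReal.lt_iff_exists_real_btwn.1 hb
    filter_upwards [hupper c hDc] with n hn
    refine lt_of_le_of_lt (EReal.coe_le_coe_iff.2 ?_) hcb
    rwa [div_le_iff₀ (hpos n)]

theorem HasURP.hasMeanDim (hX : HasURP Γ X) (hΓ : IsAmenable Γ) :
    HasMeanDim Γ X (dynDim Γ X) :=
  ⟨hΓ, fun _ hF => ⟨_, fun _ h𝒰 => hX.tendsto_coverDim hF h𝒰, rfl⟩⟩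

end Comparison

end DynDim

theorem theorem9p5 :
    -- countable amenable groups and systems with the uniform Rokhlin property
    (∀ (Γ : Type*) [Group Γ] [Countable Γ] (X : Type*) [MetricSpace X] [CompactSpace X]
        [MeasurableSpace X] [BorelSpace X] [MulAction Γ X] [ContinuousConstSMul Γ X],
        DynDim.IsAmenable Γ → DynDim.HasURP Γ X →
          DynDim.HasMeanDim Γ X (DynDim.dynDim Γ X)) ∧
    -- systems over `ℤᵏ` with the marker property
    (∀ (k : ℕ) (X : Type*) [MetricSpace X] [CompactSpace X]
        [MeasurableSpace X] [BorelSpace X] [MulAction (DynDim.ZPow k) X]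
        [ContinuousConstSMul (DynDim.ZPow k) X],
        DynDim.HasMarkerProperty (DynDim.ZPow k) X →
          DynDim.HasMeanDim (DynDim.ZPow k) X (DynDim.dynDim (DynDim.ZPow k) X)) ∧
    -- extensions of free minimal systems over `ℤᵏ`
    (∀ (k : ℕ) (X : Type*) [MetricSpace X] [CompactSpace X]
        [MeasurableSpace X] [BorelSpace X] [MulAction (DynDim.ZPow k) X]
        [ContinuousConstSMul (DynDim.ZPow k) X]
        (Y : Type*) [MetricSpace Y] [CompactSpace Y] [MulAction (DynDim.ZPow k) Y]
        [ContinuousConstSMul (DynDim.ZPow k) Y] (π : X → Y),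
        DynDim.IsFactorMap (DynDim.ZPow k) π → DynDim.IsFreeAction (DynDim.ZPow k) Y →
        MulAction.IsMinimal (DynDim.ZPow k) Y →
          DynDim.HasMeanDim (DynDim.ZPow k) X (DynDim.dynDim (DynDim.ZPow k) X)) := by
  refine ⟨?_, ?_, ?_⟩
  · intro Γ _ _ X _ _ _ _ _ _ hΓ hX
    exact hX.hasMeanDim hΓ
  · intro k X _ _ _ _ _ _ hX
    exact (DynDim.hasURP_of_hasMarkerProperty hX).hasMeanDim (DynDim.isAmenable_zPow k)
  · intro k X _ _ _ _ _ _ Y _ _ _ _ π hπ hfree hmin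
    exact (DynDim.hasURP_of_hasMarkerProperty
      (DynDim.hasMarkerProperty_of_isFactorMap hπ hfree hmin)).hasMeanDim
      (DynDim.isAmenable_zPow k)
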